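/- Let $K$ be a field, with no assumption on its characteristic or cardinality. Call a field extension $M/K$ (not necessarily algebraic) a PAC extension if for every $r\ge 1$, every absolutely irreducible $M$-variety $V$ of dimension $r$ and every dominating separable $M$-map $\nu\colon V\to\mathbb{A}^r$ there exists $a\in V(M)$ with $\nu(a)\in K^r$. For a field $M$ with separable closure $M_s$ let $\mathrm{Gal}(M)=\mathrm{Gal}(M_s/M)$. A profinite group is free of rank $\kappa$, where $\kappa$ is a finite or infinite cardinal, if it is a free profinite group on a set of cardinality $\kappa$ converging to $1$. Call $K$ Hilbertian if for every $r\ge1$ and all finite families $f_1,\dots,f_s\in K[T_1,\dots,T_r,X]$ of polynomials that are irreducible and separable as polynomials in $X$ over $K(T_1,\dots,T_r)$, the set of $a\in K^r$ such that all $f_i(a,X)$ are irreducible in $K[X]$ is Zariski dense in $\mathbb{A}^r$, that is, for every nonzero $g\in K[T_1,\dots,T_r]$ it contains some $a$ with $g(a)\neq 0$ (in particular it is nonempty). **Theorem.** Suppose that for infinitely many integers $n\ge 1$ there exists a PAC extension $M/K$ such that $\mathrm{Gal}(M)$ is a free profinite group of rank $\ge n$. Then $K$ is Hilbertian. -/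

import Mathlib

open scoped Polynomial TensorProduct Topology

universe u v

/-- `M/K` is a PAC extension: for every absolutely irreducible affine `M`-variety `V` of dimension
`r ≥ 1` and every dominating separable `M`-map `ν : V → 𝔸ʳ` there is a point `a ∈ V(M)` with
`ν(a) ∈ Kʳ`.  (Every variety has a dense affine open subvariety, so restricting to affine `V` does
not change the notion.)

The variety `V` is given by its coordinate ring `A`, a finitely generated `M`-algebra:
* `V` is absolutely irreducible: `A ⊗ M̃` is a domain, with `M̃` an algebraic closure of `M`;
* a map `ν : V → 𝔸ʳ` is an `r`-tuple `t` of elements of `A`;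
* `ν` is dominating: `t` is algebraically independent over `M`;
* `V` has dimension `r` and `ν` is separable: the function field of `V` is a separable algebraic
  extension of `M(t)`;
* an `M`-rational point `a` of `V` is an `M`-algebra homomorphism `A → M`, and `ν(a) = (a (t i))ᵢ`.

The extension `M/K` is not required to be algebraic. -/
def IsPACExtension (K : Type u) (M : Type v) [Field K] [Field M] [Algebra K M] : Prop :=
  ∀ (r : ℕ), 1 ≤ r →
  ∀ (A : Type v) [CommRing A] [IsDomain A] [Algebra M A] [Algebra.FiniteType M A],
    IsDomain (A ⊗[M] AlgebraicClosure M) →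
  ∀ t : Fin r → A,
    AlgebraicIndependent M t →
    Algebra.IsSeparable
      (IntermediateField.adjoin M (Set.range fun i => algebraMap A (FractionRing A) (t i)))
      (FractionRing A) →
  ∃ a : A →ₐ[M] M, ∀ i, a (t i) ∈ Set.range (algebraMap K M)

/-- `φ : X → G` is a basis (converging to `1`) of the profinite group `G`, i.e. `G` is the free
profinite group on the set `X` via `φ`: the map `φ` converges to `1` (every neighbourhood of `1`
contains `φ x` for all but finitely many `x`), and every map from `X` to a profinite group that
converges to `1` factors uniquely through `φ` by a continuous homomorphism. -/
structure IsFreeProfiniteBasis {G : Type v} [Group G] [TopologicalSpace G] [IsTopologicalGroup G]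
    [CompactSpace G] [TotallyDisconnectedSpace G] {X : Type v} (φ : X → G) : Prop where
  tendsto_one : Filter.Tendsto φ Filter.cofinite (𝓝 1)
  existsUnique_lift : ∀ (H : ProfiniteGrp.{v}) (ψ : X → H),
    Filter.Tendsto ψ Filter.cofinite (𝓝 1) →
      ∃! θ : G →ₜ* H, ∀ x, θ (φ x) = ψ x

/-- The profinite group `G` is free of rank `κ`: it has a basis of cardinality `κ`. -/
def IsFreeProfiniteOfRank (G : Type v) [Group G] [TopologicalSpace G] [IsTopologicalGroup G]
    [CompactSpace G] [TotallyDisconnectedSpace G] (κ : Cardinal.{v}) : Prop :=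
  ∃ (X : Type v) (φ : X → G), IsFreeProfiniteBasis φ ∧ Cardinal.mk X = κ

/-- `Gal(M)`, the Galois group over `M` of a separable closure of `M`, with the Krull topology. -/
abbrev SepAbsGaloisGroup (M : Type v) [Field M] : Type v :=
  SeparableClosure M ≃ₐ[M] SeparableClosure M

/-- `K` is Hilbertian: for every `r ≥ 1` and all `f₁, …, f_s ∈ K[T₁, …, T_r][X]` that are irreducible
and separable as polynomials in `X` over `K(T₁, …, T_r)`, the set of `a ∈ Kʳ` such that all
`fᵢ(a, X)` are irreducible in `K[X]` is Zariski dense in `Kʳ`: it meets the complement of the zero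
set of every nonzero polynomial `g`. (For `g = 1` this is the existence of such an `a`.) -/
def IsHilbertian (K : Type u) [Field K] : Prop :=
  ∀ (r : ℕ), 1 ≤ r → ∀ (s : ℕ) (f : Fin s → (MvPolynomial (Fin r) K)[X]),
    (∀ i, Irreducible
      ((f i).map (algebraMap (MvPolynomial (Fin r) K) (FractionRing (MvPolynomial (Fin r) K))))) →
    (∀ i, Polynomial.Separable
      ((f i).map (algebraMap (MvPolynomial (Fin r) K) (FractionRing (MvPolynomial (Fin r) K))))) →
    ∀ g : MvPolynomial (Fin r) K, g ≠ 0 →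
      ∃ a : Fin r → K, MvPolynomial.eval a g ≠ 0 ∧
        ∀ i, Irreducible ((f i).map (MvPolynomial.eval a))

/-! Let `E = K(T)`, let `F/E` be the splitting field of the product of the `fᵢ`, `G = Gal(F/E)`, and
`L` the algebraic closure of `K` in `F`. After inverting a suitable `h` in `K[T]`, let `R = K[T]_h`
and let `S` be its integral closure in `F`. If a specialization `χ : S → M'` into a field sends `T`
to `a ∈ Kʳ` and has a `G`-stable kernel, then each `fᵢ(a, X)` is irreducible: its roots are the
`χ(y)` for roots `y` of `fᵢ`, `G` permutes the `y` transitively, and stability makes all the `χ(y)`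
satisfy the same equations over `K` (`irreducible_map_of_equivariant`).

Such a `χ` comes from a PAC extension `M` with `Gal(M)` free of rank at least `|G|`. Restriction to
`L` gives `ρ : Gal(M) → Gal(L/K)`, which may fail to be onto. By freeness and pigeonhole it lifts to
`θ : Gal(M) → G` whose image contains `Gal(F/EL)` (`IsFreeProfiniteBasis.exists_lift`). Factor `θ`
through a finite Galois `M'/M` and twist: the invariants of `σ ⊗ θ(σ)` on `M' ⊗[L] S` form, by
Galois descent, the coordinate ring of an absolutely irreducible `M`-variety, because `F/L` is
regular. The PAC property gives an `M`-point over some `a ∈ Kʳ`, that is, `χ : S → M'` with `σ ∘ χ =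
χ ∘ θ(σ)` (`exists_twisted_point`). Its kernel is thus stable under the image of `θ`, in particular
under `Gal(F/EL)`.

Stability under all of `G` is then automatic (`map_act_eq_zero`): `χ` sends the `G`-invariants `R`
into `K` and is injective on `L`, so on the `Gal(F/EL)`-invariants, which `L` and `R` generate, the
kernel is stable under `Gal(L/K)`; a norm argument passes to all of `S`. -/

/-! ### Tensor products over a field that are domains -/

/-- Nullstellensatz: a residue field of the localization `A[1/x]` is finite over `k`, hence equal to
`k`. -/
theorem exists_algHom_ne_zero_of_isAlgClosed {k A : Type*} [Field k] [IsAlgClosed k] [CommRing A]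
    [IsDomain A] [Algebra k A] [Algebra.FiniteType k A] {x : A} (hx : x ≠ 0) :
    ∃ φ : A →ₐ[k] k, φ x ≠ 0 := by
  have hn : Nontrivial (Localization.Away x) := by
    have : Submonoid.powers x ≤ nonZeroDivisors A := powers_le_nonZeroDivisors_of_noZeroDivisors hx
    exact (IsLocalization.injective (Localization.Away x) this).nontrivial
  obtain ⟨m, hm⟩ := Ideal.exists_maximal (Localization.Away x)
  let : Field (Localization.Away x ⧸ m) := Ideal.Quotient.field m
  have : Algebra.FiniteType A (Localization.Away x) :=
    IsLocalization.finiteType_of_monoid_fg (Submonoid.powers x) _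
  have : Algebra.FiniteType k (Localization.Away x) :=
    Algebra.FiniteType.trans (S := A) inferInstance inferInstance
  have : Module.Finite k (Localization.Away x ⧸ m) := finite_of_finite_type_of_isJacobsonRing k _
  let e := AlgEquiv.ofBijective (Algebra.ofId k (Localization.Away x ⧸ m))
    IsAlgClosed.algebraMap_bijective_of_isIntegral
  refine ⟨e.symm.toAlgHom.comp ((Ideal.Quotient.mkₐ k m).comp
    (IsScalarTower.toAlgHom k A (Localization.Away x))), fun h0 => ?_⟩
  have h1 : Ideal.Quotient.mk m (algebraMap A (Localization.Away x) x) = 0 :=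
    e.symm.injective (by simpa using h0)
  have hu : IsUnit (algebraMap A (Localization.Away x) x) :=
    IsLocalization.Away.algebraMap_isUnit x
  exact (hu.map (Ideal.Quotient.mk m)).ne_zero h1

/-- Two nonzero elements with product zero have coordinates, in a basis of `B`, in a finitely
generated `A₀ ⊆ A`. A `k`-point of `A₀` at which one chosen coordinate of each is nonzero would
specialize them to zero divisors in `B`. -/
theorem isDomain_tensorProduct_of_isAlgClosed (k A B : Type*) [Field k] [IsAlgClosed k]
    [CommRing A] [IsDomain A] [Algebra k A] [CommRing B] [IsDomain B] [Algebra k B] :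
    IsDomain (A ⊗[k] B) := by
  have : Nontrivial (A ⊗[k] B) := (Algebra.TensorProduct.includeRight_injective (R := k) (A := A)
    (B := B) (algebraMap k A).injective).nontrivial
  have : NoZeroDivisors (A ⊗[k] B) := by
    refine ⟨fun {z w} hzw => ?_⟩
    by_contra! hne
    let b := Module.Basis.ofVectorSpace k B
    let β := b.baseChange A
    obtain ⟨i, hi⟩ : ∃ i, β.repr z i ≠ 0 := by
      by_contra! h
      exact hne.1 (β.repr.injective (by ext i; simpa using h i))
    obtain ⟨j, hj⟩ : ∃ j, β.repr w j ≠ 0 := by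
      by_contra! h
      exact hne.2 (β.repr.injective (by ext i; simpa using h i))
    classical
    let s : Finset A := (β.repr z).support.image (β.repr z) ∪ (β.repr w).support.image (β.repr w)
    let A₀ := Algebra.adjoin k (s : Set A)
    have : Algebra.FiniteType k A₀ := A₀.fg_iff_finiteType.1 (Subalgebra.fg_adjoin_finset s)
    have hlift : ∀ u : A ⊗[k] B, (∀ l, β.repr u l ∈ A₀) →
        ∃ v : A₀ ⊗[k] B, Algebra.TensorProduct.map A₀.val (AlgHom.id k B) v = u ∧
          ∀ l, ((b.baseChange A₀).repr v l : A) = β.repr u l := by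
      intro u hu
      let c : _ →₀ A₀ := Finsupp.onFinset (β.repr u).support (fun l => ⟨β.repr u l, hu l⟩)
        (fun l hl => by
          rw [Finsupp.mem_support_iff]; intro h; exact hl (Subtype.ext h))
      refine ⟨(b.baseChange A₀).repr.symm c, ?_, fun l => by simp [c]⟩
      conv_rhs => rw [← β.linearCombination_repr u]
      rw [Module.Basis.repr_symm_apply, Finsupp.linearCombination_apply,
        Finsupp.linearCombination_apply, Finsupp.sum_of_support_subset
          (s := (β.repr u).support) c Finsupp.support_onFinset_subset _ (by simp), Finsupp.sum,
          map_sum]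
      refine Finset.sum_congr rfl fun l _ => ?_
      simp [c, β, Module.Basis.baseChange_apply, TensorProduct.smul_tmul']
    have hmem : ∀ u ∈ ({z, w} : Set (A ⊗[k] B)), ∀ l, β.repr u l ∈ A₀ := by
      intro u hu l
      by_cases h0 : β.repr u l = 0
      · rw [h0]; exact zero_mem _
      · refine Algebra.subset_adjoin ?_
        rcases hu with rfl | rfl
        · exact Finset.mem_coe.2 (Finset.mem_union_left _
            (Finset.mem_image_of_mem _ (Finsupp.mem_support_iff.2 h0)))
        · exact Finset.mem_coe.2 (Finset.mem_union_right _
            (Finset.mem_image_of_mem _ (Finsupp.mem_support_iff.2 h0)))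
    obtain ⟨z', hz', hzc⟩ := hlift z (hmem z (by simp))
    obtain ⟨w', hw', hwc⟩ := hlift w (hmem w (by simp))
    have hinj : Function.Injective (Algebra.TensorProduct.map A₀.val (AlgHom.id k B)) :=
      Module.Flat.rTensor_preserves_injective_linearMap (M := B) A₀.val.toLinearMap
        Subtype.val_injective
    have hzw' : z' * w' = 0 := hinj (by rw [map_mul, hz', hw', hzw, map_zero])
    have hx : (b.baseChange A₀).repr z' i * (b.baseChange A₀).repr w' j ≠ 0 := by
      refine mul_ne_zero (fun h => hi ?_) (fun h => hj ?_)
      · rw [← hzc, h]; rfl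
      · rw [← hwc, h]; rfl
    obtain ⟨φ, hφ⟩ := exists_algHom_ne_zero_of_isAlgClosed (k := k) hx
    rw [map_mul] at hφ
    let ev : A₀ ⊗[k] B →ₐ[k] B := Algebra.TensorProduct.lift ((Algebra.ofId k B).comp φ)
      (AlgHom.id k B) (fun _ _ => Commute.all _ _)
    have hev : ∀ (u : A₀ ⊗[k] B) l, b.repr (ev u) l = φ ((b.baseChange A₀).repr u l) := by
      intro u l
      induction u with
      | zero => simp
      | add x y hx hy => simp [hx, hy]
      | tmul x y =>
        have : ev (x ⊗ₜ y) = φ x • y := by simp [ev, Algebra.smul_def, Algebra.ofId_apply]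
        rw [this]
        simp [Module.Basis.baseChange_repr_tmul, mul_comm]
    have h0 : ev z' * ev w' = 0 := by rw [← map_mul, hzw', map_zero]
    rcases mul_eq_zero.1 h0 with h | h
    · exact (left_ne_zero_of_mul hφ) (by rw [← hev, h]; simp)
    · exact (right_ne_zero_of_mul hφ) (by rw [← hev, h]; simp)
  exact NoZeroDivisors.to_isDomain _

theorem isDomain_tensorProduct_of_isAlgClosed_tower (L C F Ω : Type*) [Field L] [Field C]
    [IsAlgClosed C] [Field F] [Field Ω] [Algebra L C] [Algebra L F] [Algebra L Ω] [Algebra C Ω]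
    [IsScalarTower L C Ω] [IsDomain (C ⊗[L] F)] : IsDomain (F ⊗[L] Ω) := by
  have : IsDomain (Ω ⊗[C] (C ⊗[L] F)) := isDomain_tensorProduct_of_isAlgClosed C Ω _
  exact ((Algebra.TensorProduct.comm L F Ω).toRingEquiv.trans
    (Algebra.TensorProduct.cancelBaseChange L C C Ω F).symm.toRingEquiv).toMulEquiv.isDomain

/-- Base change along `L[T] → Ω[T]` embeds `F ⊗[L] Ω` into an étale algebra over the field `Ω(T)`,
and such algebras are reduced. -/
theorem isReduced_tensorProduct_of_formallyEtale (L F Ω : Type*) (ι : Type*) [Field L] [Field F]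
    [Field Ω] [Algebra L F] [Algebra L Ω] [Algebra (MvPolynomial ι L) F]
    [IsScalarTower L (MvPolynomial ι L) F] [FaithfulSMul (MvPolynomial ι L) F]
    [Algebra.FormallyEtale (MvPolynomial ι L) F] [Algebra.EssFiniteType (MvPolynomial ι L) F] :
    IsReduced (F ⊗[L] Ω) := by
  let := FractionRing.liftAlgebra (MvPolynomial ι L) F
  have : Module.Flat (MvPolynomial ι L) F :=
    Module.Flat.trans (MvPolynomial ι L) (FractionRing (MvPolynomial ι L)) F
  let Q := MvPolynomial ι L ⊗[L] Ω
  let eQ : Q ≃ₐ[L] MvPolynomial ι Ω :=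
    (Algebra.TensorProduct.comm L (MvPolynomial ι L) Ω).trans
      ((MvPolynomial.algebraTensorAlgEquiv L Ω).restrictScalars L)
  have : IsDomain Q := eQ.toMulEquiv.isDomain
  let W := FractionRing Q
  have : IsReduced (W ⊗[MvPolynomial ι L] F) :=
    Algebra.FormallyUnramified.isReduced_of_field W (W ⊗[MvPolynomial ι L] F)
  have e1 : F ⊗[MvPolynomial ι L] Q ≃ₐ[F] F ⊗[L] Ω :=
    Algebra.TensorProduct.cancelBaseChange L (MvPolynomial ι L) F F Ω
  have : IsReduced (F ⊗[MvPolynomial ι L] Q) := by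
    have hinj : Function.Injective (Algebra.TensorProduct.map
        (AlgHom.id (MvPolynomial ι L) F) (IsScalarTower.toAlgHom (MvPolynomial ι L) Q W)) :=
      Module.Flat.lTensor_preserves_injective_linearMap (M := F)
        (IsScalarTower.toAlgHom (MvPolynomial ι L) Q W).toLinearMap
        (IsFractionRing.injective Q W)
    exact isReduced_of_injective (((Algebra.TensorProduct.comm (MvPolynomial ι L) F W).toAlgHom).comp
      (Algebra.TensorProduct.map
        (AlgHom.id (MvPolynomial ι L) F) (IsScalarTower.toAlgHom (MvPolynomial ι L) Q W)))
        ((Algebra.TensorProduct.comm (MvPolynomial ι L) F W).injective.comp hinj)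
  exact isReduced_of_injective e1.symm e1.symm.injective

/-- The minimal polynomial over `F` divides the one over `L`, so its coefficients are algebraic over
`L`, hence in `L`. -/
theorem minpoly_map_eq_of_algebraicClosure_eq_bot {L F Ω : Type*} [Field L] [Field F] [Field Ω]
    [Algebra L F] [Algebra F Ω] [Algebra L Ω] [IsScalarTower L F Ω]
    (hcl : algebraicClosure L F = ⊥) {x : Ω} (hx : IsIntegral L x) :
    (minpoly L x).map (algebraMap L F) = minpoly F x := by
  have hdvd := minpoly.dvd_map_of_isScalarTower L F x
  have hF : IsIntegral F x := hx.tower_top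
  have hlift : minpoly F x ∈ Polynomial.lifts (algebraMap L F) := by
    rw [Polynomial.lifts_iff_coeff_lifts]
    intro n
    have h1 : IsIntegral L ((minpoly F x).coeff n) :=
      Polynomial.isIntegral_coeff_of_dvd _ _ (minpoly.monic hx) (minpoly.monic hF) hdvd n
    have h2 : (minpoly F x).coeff n ∈ algebraicClosure L F :=
      mem_algebraicClosure_iff.2 h1.isAlgebraic
    rw [hcl, IntermediateField.mem_bot] at h2
    exact h2
  obtain ⟨g, hg, -, hgm⟩ := Polynomial.lifts_and_natDegree_eq_and_monic hlift (minpoly.monic hF)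
  have hgx : Polynomial.aeval x g = 0 := by
    rw [← Polynomial.aeval_map_algebraMap F, hg, minpoly.aeval]
  have hdvd' : (minpoly L x).map (algebraMap L F) ∣ minpoly F x := by
    rw [← hg]
    exact Polynomial.map_dvd _ (minpoly.dvd L x hgx)
  exact Polynomial.eq_of_monic_of_associated ((minpoly.monic hx).map _) (minpoly.monic hF)
    (associated_of_dvd_dvd hdvd' hdvd)

/-- It suffices to test finite subextensions; each has a primitive element, whose degree does not
drop over `F`. -/
theorem separableClosure_linearDisjoint {L F Ω : Type*} [Field L] [Field F] [Field Ω]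
    [Algebra L F] [Algebra F Ω] [Algebra L Ω] [IsScalarTower L F Ω]
    (hcl : algebraicClosure L F = ⊥) : (separableClosure L Ω).LinearDisjoint F := by
  have : Algebra.IsIntegral L (separableClosure L Ω).toSubalgebra :=
    inferInstanceAs (Algebra.IsIntegral L (separableClosure L Ω))
  refine Subalgebra.LinearDisjoint.of_linearDisjoint_finite_left _ _ fun A' hA' hfin => ?_
  let A : IntermediateField L Ω := A'.toIntermediateField' (by
    exact (Algebra.IsIntegral.isField_iff_isField (R := L) (S := A')
      (algebraMap L A').injective).1 (Field.toIsField L))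
  have : FiniteDimensional L A := hfin
  have hle : A ≤ separableClosure L Ω := hA'
  have : Algebra.IsSeparable L A := (le_separableClosure_iff L Ω A).1 hle
  let pb := Field.powerBasisOfFiniteOfSeparable L A
  refine IntermediateField.LinearDisjoint.of_basis_left (A := A) (L := F) pb.basis ?_
  have hint : IsIntegral L (pb.gen : Ω) := pb.isIntegral_gen.map A.val
  have hdeg : (minpoly F (pb.gen : Ω)).natDegree = pb.dim := by
    rw [← minpoly_map_eq_of_algebraicClosure_eq_bot hcl hint, Polynomial.natDegree_map,
      ← pb.natDegree_minpoly]
    congr 1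
    exact (minpoly.algebraMap_eq (algebraMap A Ω).injective pb.gen)
  have := linearIndependent_pow (K := F) (pb.gen : Ω)
  rw [hdeg] at this
  convert this using 1
  ext i
  simp

/-- Linear disjointness handles the separable constants. The remaining constants are purely
inseparable, so some `q`-power of each element comes from the separable part; reducedness then
excludes zero divisors. Past the algebraic closure of `L` in `Ω` the base is algebraically closed.
-/
theorem isDomain_tensorProduct_of_algebraicClosure_eq_bot (L F Ω : Type*) [Field L] [Field F]
    [Field Ω] [IsAlgClosed Ω] [Algebra L F] [Algebra L Ω]
    (hcl : algebraicClosure L F = ⊥) [IsReduced (F ⊗[L] algebraicClosure L Ω)] :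
    IsDomain (F ⊗[L] Ω) := by
  let C := algebraicClosure L Ω
  let Cs := separableClosure L C
  let Λ := AlgebraicClosure F
  let D := separableClosure L Λ
  have : IsDomain (D ⊗[L] F) := (separableClosure_linearDisjoint (Ω := Λ) hcl).isDomain
  have : IsAlgClosed C := IsAlgClosure.isAlgClosed L
  let φ : C →ₐ[L] Λ := IsAlgClosed.lift
  let ψ : Cs →ₐ[L] D := (φ.comp Cs.val).codRestrict D.toSubalgebra fun x =>
    mem_separableClosure_iff.2 ((mem_separableClosure_iff.1 x.2).map φ φ.injective)
  have hψ : Function.Injective (Algebra.TensorProduct.map ψ (AlgHom.id L F)) :=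
    Module.Flat.rTensor_preserves_injective_linearMap (M := F) ψ.toLinearMap ψ.toRingHom.injective
  have hDs : NoZeroDivisors (Cs ⊗[L] F) :=
    hψ.noZeroDivisors _ (map_zero _) (map_mul _)
  let j := Algebra.TensorProduct.map Cs.val (AlgHom.id L F)
  have hj : Function.Injective j :=
    Module.Flat.rTensor_preserves_injective_linearMap (M := F) Cs.val.toLinearMap
      Cs.val.toRingHom.injective
  obtain ⟨q, hq⟩ := ExpChar.exists L
  have : ExpChar C q := expChar_of_injective_algebraMap (algebraMap L C).injective q
  have : Nontrivial (C ⊗[L] F) := (Algebra.TensorProduct.includeLeft_injective (R := L) (S := L)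
    (A := C) (B := F) (algebraMap L F).injective).nontrivial
  have : ExpChar (C ⊗[L] F) q :=
    expChar_of_injective_algebraMap (algebraMap L (C ⊗[L] F)).injective q
  have hpow : ∀ z : C ⊗[L] F, ∃ n : ℕ, z ^ q ^ n ∈ j.range := by
    intro z
    induction z with
    | zero => exact ⟨0, by simp⟩
    | tmul x y =>
      obtain ⟨n, u, hu⟩ := IsPurelyInseparable.pow_mem (F := Cs) q x
      refine ⟨n, u ⊗ₜ (y ^ q ^ n), ?_⟩
      rw [Algebra.TensorProduct.tmul_pow, ← hu]
      rfl
    | add x y hx hy =>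
      obtain ⟨m, hm⟩ := hx
      obtain ⟨n, hn⟩ := hy
      refine ⟨m + n, ?_⟩
      rw [show (x + y) ^ q ^ (m + n) = x ^ q ^ (m + n) + y ^ q ^ (m + n) from
        add_pow_expChar_pow (R := C ⊗[L] F) x y q (m + n)]
      refine add_mem ?_ ?_
      · rw [pow_add, pow_mul]; exact pow_mem hm _
      · rw [add_comm, pow_add, pow_mul]; exact pow_mem hn _
  have : IsReduced (C ⊗[L] F) := isReduced_of_injective (Algebra.TensorProduct.comm L C F)
    (Algebra.TensorProduct.comm L C F).injective
  have : NoZeroDivisors (C ⊗[L] F) := by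
    refine ⟨fun {z w} hzw => ?_⟩
    obtain ⟨m, z', hz⟩ := hpow z
    obtain ⟨n, w', hw⟩ := hpow w
    have hq0 : ∀ k, q ^ k ≠ 0 := fun k => pow_ne_zero _ (expChar_pos L q).ne'
    have h0 : z' ^ q ^ n * w' ^ q ^ m = 0 := hj (by
      rw [map_mul, map_pow, map_pow, map_zero]
      change (j.toRingHom z') ^ _ * (j.toRingHom w') ^ _ = 0
      rw [hz, hw, ← pow_mul, ← pow_mul, mul_comm (q ^ n), ← mul_pow, hzw,
        zero_pow (mul_ne_zero (hq0 _) (hq0 _))])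
    rcases mul_eq_zero.1 h0 with h | h
    · left
      rw [pow_eq_zero_iff (hq0 _)] at h
      exact eq_zero_of_pow_eq_zero (n := q ^ m) (by rw [← hz, h]; exact map_zero _)
    · right
      rw [pow_eq_zero_iff (hq0 _)] at h
      exact eq_zero_of_pow_eq_zero (n := q ^ n) (by rw [← hw, h]; exact map_zero _)
  have : IsDomain (C ⊗[L] F) := NoZeroDivisors.to_isDomain (C ⊗[L] F)
  exact isDomain_tensorProduct_of_isAlgClosed_tower L C F Ω

/-! ### Galois descent -/

/-- A basis and its trace dual. Trace duality says `Q * P = 1` for the square matrices of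
conjugates; `P * Q = 1` gives the other orthogonality relations. -/
theorem exists_galois_dual_families (M M' : Type*) [Field M] [Field M'] [Algebra M M']
    [FiniteDimensional M M'] [IsGalois M M'] :
    ∃ (ι : Type) (_ : Fintype ι) (_ : DecidableEq ι) (b : Module.Basis ι M M') (d : ι → M'),
      ∑ i, b i * d i = 1 ∧ (∀ σ : M' ≃ₐ[M] M', σ ≠ 1 → ∑ i, σ (b i) * d i = 0) ∧
      ∀ i j, ∑ σ : M' ≃ₐ[M] M', σ (d i) * σ (b j) = if i = j then 1 else 0 := by
  classical
  let b := Module.finBasis M M'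
  let d := (Algebra.traceForm M M').dualBasis (traceForm_nondegenerate M M') b
  have hdb : ∀ i j, ∑ σ : M' ≃ₐ[M] M', σ (d i) * σ (b j) = if i = j then 1 else 0 := by
    intro i j
    have h1 := (Algebra.traceForm M M').apply_dualBasis_left (traceForm_nondegenerate M M') b i j
    rw [Algebra.traceForm_apply] at h1
    have h2 := trace_eq_sum_automorphisms (K := M) (d i * b j)
    rw [h1] at h2
    simp only [map_mul] at h2
    rw [← h2]
    by_cases hij : i = j
    · rw [if_pos hij, if_pos hij.symm, map_one]
    · rw [if_neg hij, if_neg (Ne.symm hij), map_zero]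
  let P : Matrix (M' ≃ₐ[M] M') (Fin (Module.finrank M M')) M' := fun σ i => σ (b i)
  let Q : Matrix (Fin (Module.finrank M M')) (M' ≃ₐ[M] M') M' := fun i σ => σ (d i)
  have hQP : Q * P = 1 := by
    ext i j
    rw [Matrix.mul_apply, Matrix.one_apply]
    exact hdb i j
  have hcard : Fintype.card (M' ≃ₐ[M] M') = Fintype.card (Fin (Module.finrank M M')) := by
    rw [Fintype.card_fin, ← IsGalois.card_aut_eq_finrank, Nat.card_eq_fintype_card]
  have hPQ : P * Q = 1 := (Matrix.mul_eq_one_comm_of_equiv (Fintype.equivOfCardEq hcard)).2 hQP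
  have hσ : ∀ σ : M' ≃ₐ[M] M', ∑ i, σ (b i) * d i =
      (1 : Matrix (M' ≃ₐ[M] M') (M' ≃ₐ[M] M') M') σ 1 := fun σ => by
    rw [← hPQ, Matrix.mul_apply]
    rfl
  refine ⟨_, inferInstance, inferInstance, b, d, ?_, fun σ hs => ?_, hdb⟩
  · exact (hσ 1).trans (Matrix.one_apply_eq 1)
  · exact (hσ σ).trans (Matrix.one_apply_ne hs)

/-- The subalgebra of elements fixed by a group acting by algebra automorphisms. -/
def Subalgebra.fixedBy {M B Γ : Type*} [CommRing M] [CommRing B] [Algebra M B] [Group Γ]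
    (ρ : Γ →* (B ≃ₐ[M] B)) : Subalgebra M B where
  carrier := {x | ∀ σ, ρ σ x = x}
  mul_mem' ha hb σ := by rw [map_mul, ha σ, hb σ]
  add_mem' ha hb σ := by rw [map_add, ha σ, hb σ]
  algebraMap_mem' x σ := (ρ σ).commutes x

/-- The dual families give an explicit descent: the traces of `b i * x` are invariant and are the
coefficients of `x` on the `d i`, while orthogonality isolates each coefficient of a relation among
the `b i`. -/
theorem bijective_lift_fixedBy {M M' B : Type*} [Field M] [Field M'] [Algebra M M']
    [FiniteDimensional M M'] [IsGalois M M'] [CommRing B] [Algebra M B] [Algebra M' B]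
    [IsScalarTower M M' B] (ρ : (M' ≃ₐ[M] M') →* (B ≃ₐ[M] B))
    (hρ : ∀ σ x, ρ σ (algebraMap M' B x) = algebraMap M' B (σ x)) :
    Function.Bijective (Algebra.TensorProduct.lift (Algebra.ofId M' B) (Subalgebra.fixedBy ρ).val
      (fun _ _ => Commute.all _ _) : M' ⊗[M] Subalgebra.fixedBy ρ →ₐ[M'] B) := by
  classical
  obtain ⟨ι, _, _, b, d, h1, h1', h2⟩ := exists_galois_dual_families M M'
  constructor
  · rw [injective_iff_map_eq_zero]
    intro z hz
    obtain ⟨c, rfl⟩ := TensorProduct.eq_repr_basis_left b z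
    suffices c = 0 by rw [this]; simp
    ext j
    rw [Finsupp.sum_fintype _ _ (by simp), map_sum] at hz
    simp only [Algebra.TensorProduct.lift_tmul, Algebra.ofId_apply, Subalgebra.coe_val] at hz
    have h3 : ∑ σ : M' ≃ₐ[M] M', algebraMap M' B (σ (d j)) *
        ρ σ (∑ i, algebraMap M' B (b i) * (c i : B)) = 0 := by rw [hz]; simp
    have h4 : ∑ i, algebraMap M' B (∑ σ : M' ≃ₐ[M] M', σ (d j) * σ (b i)) * (c i : B) = 0 := by
      rw [← h3]
      simp only [map_sum, map_mul, hρ, Finset.mul_sum, Finset.sum_mul]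
      rw [Finset.sum_comm]
      refine Finset.sum_congr rfl fun σ _ => Finset.sum_congr rfl fun i _ => ?_
      rw [(c i).2 σ, mul_assoc]
    simp only [h2] at h4
    simpa using h4
  · intro x
    have hmem : ∀ i, ∑ σ : M' ≃ₐ[M] M', ρ σ (algebraMap M' B (b i) * x) ∈
        Subalgebra.fixedBy ρ := by
      intro i τ
      rw [map_sum]
      refine Fintype.sum_equiv (Equiv.mulLeft τ) _ _ fun σ => ?_
      simp
    refine ⟨∑ i, d i ⊗ₜ ⟨_, hmem i⟩, ?_⟩
    rw [map_sum]
    simp only [Algebra.TensorProduct.lift_tmul, Algebra.ofId_apply, Subalgebra.coe_val]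
    have : ∀ σ : M' ≃ₐ[M] M', ∑ i, algebraMap M' B (d i) * ρ σ (algebraMap M' B (b i) * x) =
        algebraMap M' B (∑ i, σ (b i) * d i) * ρ σ x := by
      intro σ
      rw [map_sum, Finset.sum_mul]
      refine Finset.sum_congr rfl fun i _ => ?_
      rw [map_mul, hρ, map_mul]; ring
    simp only [Finset.mul_sum]
    rw [Finset.sum_comm]
    simp only [this]
    rw [Finset.sum_eq_single 1]
    · simp [h1]
    · intro σ _ hσ
      rw [h1' σ hσ, map_zero, zero_mul]
    · simp

/-! ### Separability of function fields and a usable form of the PAC property -/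

theorem isSeparable_of_eval₂_eq_zero {T Y P : Type*} [Field T] [Field Y] [Algebra T Y]
    [CommRing P] [IsDomain P] (φ : P →+* T) (hφ : Function.Injective φ) {p : P[X]}
    (hp : (p.map (algebraMap P (FractionRing P))).Separable) {y : Y}
    (hy : p.eval₂ ((algebraMap T Y).comp φ) y = 0) : IsSeparable T y := by
  have hφ' : (IsFractionRing.lift hφ : FractionRing P →+* T).comp
      (algebraMap P (FractionRing P)) = φ :=
    RingHom.ext fun x => IsFractionRing.lift_algebraMap hφ x
  have h1 : (p.map φ).Separable := by
    rw [← hφ', ← Polynomial.map_map]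
    exact hp.map
  refine h1.of_dvd (minpoly.dvd _ _ ?_)
  rw [Polynomial.aeval_def, Polynomial.eval₂_map]
  exact hy

theorem isSeparable_of_adjoin_eq_top {M T Y B P : Type*} [Field M] [Field T] [Field Y]
    [Algebra M T] [Algebra T Y] [Algebra M Y] [IsScalarTower M T Y] [CommRing B] [IsDomain B]
    [Algebra M B] [Algebra B Y] [IsScalarTower M B Y] [IsFractionRing B Y] [CommRing P]
    [IsDomain P] (φ : P →+* T) (hφ : Function.Injective φ) {s : Set B}
    (hs : Algebra.adjoin M s = ⊤)
    (hsep : ∀ x ∈ s, ∃ p : P[X], (p.map (algebraMap P (FractionRing P))).Separable ∧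
      p.eval₂ ((algebraMap T Y).comp φ) (algebraMap B Y x) = 0) :
    Algebra.IsSeparable T Y := by
  have hB : ∀ x : B, IsSeparable T (algebraMap B Y x) := by
    intro x
    have hx : x ∈ Algebra.adjoin M s := hs ▸ Algebra.mem_top
    induction hx using Algebra.adjoin_induction with
    | mem x hx =>
      obtain ⟨p, hp, hpx⟩ := hsep x hx
      exact isSeparable_of_eval₂_eq_zero φ hφ hp hpx
    | algebraMap c =>
      rw [← IsScalarTower.algebraMap_apply, IsScalarTower.algebraMap_apply M T Y]
      exact isSeparable_algebraMap _
    | add x y _ _ hx hy =>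
      rw [map_add]
      exact mem_separableClosure_iff.1
        (add_mem (mem_separableClosure_iff.2 hx) (mem_separableClosure_iff.2 hy))
    | mul x y _ _ hx hy =>
      rw [map_mul]
      exact mem_separableClosure_iff.1
        (mul_mem (mem_separableClosure_iff.2 hx) (mem_separableClosure_iff.2 hy))
  refine (separableClosure.eq_top_iff T Y).1 (eq_top_iff.2 fun x _ => ?_)
  obtain ⟨a, b, -, rfl⟩ := IsFractionRing.div_surjective B x
  exact div_mem (mem_separableClosure_iff.2 (hB a)) (mem_separableClosure_iff.2 (hB b))

/-- Separability is checked on generators of an overring `B` and then inherited by the fraction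
field of `A`. For a twisted form `A`, generators are explicit only after splitting it. -/
theorem isSeparable_adjoin_of_adjoin_eq_top {M A B : Type*} {r : ℕ} [Field M]
    [CommRing A] [IsDomain A] [Algebra M A] [CommRing B] [IsDomain B] [Algebra M B]
    (j : A →ₐ[M] B) (hj : Function.Injective j) {t : Fin r → A} (ht : AlgebraicIndependent M t)
    {s : Set B} (hs : Algebra.adjoin M s = ⊤)
    (hsep : ∀ x ∈ s, ∃ p : (MvPolynomial (Fin r) M)[X],
      (p.map (algebraMap _ (FractionRing (MvPolynomial (Fin r) M)))).Separable ∧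
        p.eval₂ ((j : A →+* B).comp (MvPolynomial.aeval t : _ →ₐ[M] A)) x = 0)
    (X Y : Type*) [Field X] [Algebra A X] [IsFractionRing A X] [Algebra M X] [IsScalarTower M A X]
    [Field Y] [Algebra B Y] [IsFractionRing B Y] [Algebra M Y] [IsScalarTower M B Y] :
    Algebra.IsSeparable
      (IntermediateField.adjoin M (Set.range fun i => algebraMap A X (t i))) X := by
  have hinj : Function.Injective ((IsScalarTower.toAlgHom M B Y).comp j) :=
    (IsFractionRing.injective B Y).comp hj
  let jf : X →ₐ[M] Y := IsFractionRing.liftAlgHom (g := (IsScalarTower.toAlgHom M B Y).comp j) hinj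
  have hjf : ∀ a, jf (algebraMap A X a) = algebraMap B Y (j a) :=
    fun a => IsFractionRing.lift_algebraMap hinj a
  let := jf.toRingHom.toAlgebra
  have : IsScalarTower M X Y := .of_algebraMap_eq fun x => (jf.commutes x).symm
  have htf : ∀ i, algebraMap A X (t i) ∈
      IntermediateField.adjoin M (Set.range fun i => algebraMap A X (t i)) := fun i =>
    IntermediateField.subset_adjoin _ _ ⟨i, rfl⟩
  -- Only the membership of the `t i` in this subfield matters from here on.
  generalize IntermediateField.adjoin M (Set.range fun i => algebraMap A X (t i)) = T at *
  let φ : MvPolynomial (Fin r) M →ₐ[M] T := MvPolynomial.aeval fun i => ⟨_, htf i⟩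
  have hφ : T.val.comp φ = (IsScalarTower.toAlgHom M A X).comp (MvPolynomial.aeval t) := by
    ext i; simp [φ]
  have hφi : Function.Injective φ := by
    have : Function.Injective (T.val ∘ φ) := by
      rw [← AlgHom.coe_comp, hφ]
      exact (IsFractionRing.injective A X).comp ht
    exact Function.Injective.of_comp this
  have : Algebra.IsSeparable T Y := by
    refine isSeparable_of_adjoin_eq_top (B := B) (φ : MvPolynomial (Fin r) M →+* T) hφi hs fun x hx => ?_
    obtain ⟨p, hp, hpx⟩ := hsep x hx
    refine ⟨p, hp, ?_⟩
    have h1 := congrArg (algebraMap B Y) hpx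
    rw [map_zero, Polynomial.hom_eval₂] at h1
    rw [← h1]
    congr 1
    refine RingHom.ext fun x => ?_
    have h2 := congrArg jf (DFunLike.congr_fun hφ x)
    refine h2.trans ?_
    exact hjf _
  exact Algebra.isSeparable_tower_bot_of_isSeparable T X Y

theorem isSeparable_fractionRing_of_adjoin_eq_top {M A B : Type*} {r : ℕ} [Field M]
    [CommRing A] [IsDomain A] [Algebra M A] [CommRing B] [IsDomain B] [Algebra M B]
    (j : A →ₐ[M] B) (hj : Function.Injective j) {t : Fin r → A} (ht : AlgebraicIndependent M t)
    {s : Set B} (hs : Algebra.adjoin M s = ⊤)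
    (hsep : ∀ x ∈ s, ∃ p : (MvPolynomial (Fin r) M)[X],
      (p.map (algebraMap _ (FractionRing (MvPolynomial (Fin r) M)))).Separable ∧
        p.eval₂ ((j : A →+* B).comp (MvPolynomial.aeval t : _ →ₐ[M] A)) x = 0) :
    Algebra.IsSeparable
      (IntermediateField.adjoin M (Set.range fun i => algebraMap A (FractionRing A) (t i)))
      (FractionRing A) := by
  exact isSeparable_adjoin_of_adjoin_eq_top j hj ht hs hsep (FractionRing A) (FractionRing B)

theorem Algebra.FiniteType.exists_equiv (M : Type v) (A : Type*) [Field M] [CommRing A]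
    [Algebra M A] [Algebra.FiniteType M A] :
    ∃ (A' : Type v) (_ : CommRing A') (_ : Algebra M A'), Nonempty (A' ≃ₐ[M] A) := by
  obtain ⟨n, f, hf⟩ := Algebra.FiniteType.iff_quotient_mvPolynomial''.1
    (inferInstance : Algebra.FiniteType M A)
  exact ⟨MvPolynomial (Fin n) M ⧸ RingHom.ker f, inferInstance, inferInstance,
    ⟨Ideal.quotientKerAlgEquivOfSurjective hf⟩⟩

/-- The PAC property freed from its universe constraint on `A`, with separability tested on
generators of an overring. -/
theorem IsPACExtension.exists_algHom {K : Type u} {M : Type v} [Field K] [Field M] [Algebra K M]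
    (h : IsPACExtension K M) {r : ℕ} (hr : 1 ≤ r) {A B : Type*} [CommRing A] [Algebra M A]
    [Algebra.FiniteType M A] [IsDomain (A ⊗[M] AlgebraicClosure M)]
    [CommRing B] [IsDomain B] [Algebra M B]
    (j : A →ₐ[M] B) (hj : Function.Injective j) {t : Fin r → A} (ht : AlgebraicIndependent M t)
    {s : Set B} (hs : Algebra.adjoin M s = ⊤)
    (hsep : ∀ x ∈ s, ∃ p : (MvPolynomial (Fin r) M)[X],
      (p.map (algebraMap _ (FractionRing (MvPolynomial (Fin r) M)))).Separable ∧
        p.eval₂ ((j : A →+* B).comp (MvPolynomial.aeval t : _ →ₐ[M] A)) x = 0) :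
    ∃ a : A →ₐ[M] M, ∀ i, a (t i) ∈ Set.range (algebraMap K M) := by
  obtain ⟨A', _, _, ⟨e⟩⟩ := Algebra.FiniteType.exists_equiv.{v} M A
  have : IsDomain A := hj.isDomain j.toRingHom
  have : IsDomain A' := e.toMulEquiv.isDomain
  have : Algebra.FiniteType M A' := Algebra.FiniteType.equiv ‹_› e.symm
  have hA' : IsDomain (A' ⊗[M] AlgebraicClosure M) :=
    (Algebra.TensorProduct.congr e (AlgEquiv.refl : AlgebraicClosure M ≃ₐ[M] _)).toMulEquiv.isDomain
  have ht' : AlgebraicIndependent M (fun i => e.symm (t i)) := ht.map' (f := e.symm.toAlgHom) e.symm.injective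
  have hcomp : (j.comp e.toAlgHom).comp (MvPolynomial.aeval fun i => e.symm (t i)) =
      j.comp (MvPolynomial.aeval t) := by
    ext; simp
  obtain ⟨a, ha⟩ := h r hr A' hA' _ ht'
    (isSeparable_fractionRing_of_adjoin_eq_top (j.comp e.toAlgHom) (hj.comp e.injective) ht' hs
      (fun x hx => by
        obtain ⟨p, hp, hpx⟩ := hsep x hx
        refine ⟨p, hp, ?_⟩
        rw [← hpx]
        congr 1
        exact congrArg AlgHom.toRingHom hcomp))
  exact ⟨a.comp e.symm.toAlgHom, ha⟩

/-! ### Twisted forms and their rational points -/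

/-- The ring homomorphism out of a tensor product given by two ring homomorphisms which agree on
the base ring. -/
noncomputable def Algebra.TensorProduct.liftRingHom {L A B C : Type*} [CommRing L] [CommRing A]
    [CommRing B] [CommRing C] [Algebra L A] [Algebra L B] (f : A →+* C) (g : B →+* C)
    (h : f.comp (algebraMap L A) = g.comp (algebraMap L B)) : A ⊗[L] B →+* C :=
  letI := (f.comp (algebraMap L A)).toAlgebra
  (Algebra.TensorProduct.lift (R := L) (S := L)
    { f with commutes' := fun _ => rfl }
    { g with commutes' := fun x => (RingHom.congr_fun h x).symm }
    (fun _ _ => Commute.all _ _)).toRingHom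

theorem Algebra.TensorProduct.liftRingHom_tmul {L A B C : Type*} [CommRing L] [CommRing A]
    [CommRing B] [CommRing C] [Algebra L A] [Algebra L B] (f : A →+* C) (g : B →+* C)
    (h : f.comp (algebraMap L A) = g.comp (algebraMap L B)) (a : A) (b : B) :
    Algebra.TensorProduct.liftRingHom f g h (a ⊗ₜ b) = f a * g b := by
  simp [liftRingHom]

theorem isDomain_tensorProduct_of_algEquiv {M M' L S A Ω : Type*} [Field M] [Field M'] [Field L]
    [Field Ω] [CommRing S] [CommRing A] [Algebra M M'] [Algebra L M'] [Algebra L S] [Algebra M A]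
    [Algebra M Ω] [Algebra M' Ω] [Algebra L Ω] [IsScalarTower M M' Ω] [IsScalarTower L M' Ω]
    (e : M' ⊗[M] A ≃ₐ[M'] M' ⊗[L] S) [IsDomain (S ⊗[L] Ω)] : IsDomain (A ⊗[M] Ω) := by
  let e1 : Ω ⊗[M'] (M' ⊗[M] A) ≃ₐ[Ω] Ω ⊗[M] A :=
    Algebra.TensorProduct.cancelBaseChange M M' Ω Ω A
  let e2 : Ω ⊗[M'] (M' ⊗[L] S) ≃ₐ[Ω] Ω ⊗[L] S :=
    Algebra.TensorProduct.cancelBaseChange L M' Ω Ω S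
  let e3 : Ω ⊗[M'] (M' ⊗[M] A) ≃ₐ[M'] Ω ⊗[M'] (M' ⊗[L] S) :=
    Algebra.TensorProduct.congr AlgEquiv.refl e
  exact ((Algebra.TensorProduct.comm M A Ω).toRingEquiv.trans (e1.symm.toRingEquiv.trans
    (e3.toRingEquiv.trans (e2.toRingEquiv.trans
      (Algebra.TensorProduct.comm L Ω S).toRingEquiv)))).toMulEquiv.isDomain

theorem AlgebraicIndependent.one_tmul {L M' S ι : Type*} [Field L] [Field M'] [CommRing S]
    [Algebra L M'] [Algebra L S] {t : ι → S} (ht : AlgebraicIndependent L t) :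
    AlgebraicIndependent M' (fun i => (1 : M') ⊗ₜ[L] t i) := by
  have h1 : Function.Injective (Algebra.TensorProduct.map (AlgHom.id M' M')
      (MvPolynomial.aeval t : MvPolynomial ι L →ₐ[L] S)) :=
    Module.Flat.lTensor_preserves_injective_linearMap (M := M')
      (MvPolynomial.aeval t : MvPolynomial ι L →ₐ[L] S).toLinearMap ht
  have h2 : (MvPolynomial.aeval fun i => (1 : M') ⊗ₜ[L] t i) =
      (Algebra.TensorProduct.map (AlgHom.id M' M')
        (MvPolynomial.aeval t : MvPolynomial ι L →ₐ[L] S)).comp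
      (MvPolynomial.algebraTensorAlgEquiv L M').symm.toAlgHom := by
    ext i
    simp
  rw [algebraicIndependent_iff_injective_aeval, h2]
  exact h1.comp (MvPolynomial.algebraTensorAlgEquiv L M').symm.injective

theorem Polynomial.Separable.map_fractionRing {P Q X Y : Type*} [CommRing P] [IsDomain P]
    [CommRing Q] [IsDomain Q] [Field X] [Field Y] [Algebra P X] [Algebra Q Y] [IsFractionRing P X]
    [IsFractionRing Q Y] (g : P →+* Q) (hg : Function.Injective g) {p : P[X]}
    (hp : (p.map (algebraMap P X)).Separable) : ((p.map g).map (algebraMap Q Y)).Separable := by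
  have hinj : Function.Injective ((algebraMap Q Y).comp g) :=
    (IsFractionRing.injective Q Y).comp hg
  have h1 : (IsFractionRing.lift hinj : X →+* Y).comp
      (algebraMap P X) = (algebraMap Q Y).comp g :=
    RingHom.ext fun x => IsFractionRing.lift_algebraMap hinj x
  rw [Polynomial.map_map, ← h1, ← Polynomial.map_map]
  exact hp.map

section TensorAction

variable {K M M' L S : Type*} [Field K] [Field M] [Field M'] [Field L] [CommRing S]
  [Algebra M M'] [Algebra L M'] [Algebra K S] [Algebra L S]

/-- The semilinear ring endomorphism of `M' ⊗[L] S` obtained from compatible ring endomorphisms of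
`M'`, `L`, `S`. -/
noncomputable def tensorSemilinearMap (f : M' →+* M') (g : S →+* S) (l : L → L)
    (hg : ∀ x, g (algebraMap L S x) = algebraMap L S (l x))
    (hf : ∀ x, f (algebraMap L M' x) = algebraMap L M' (l x)) : M' ⊗[L] S →+* M' ⊗[L] S :=
  Algebra.TensorProduct.liftRingHom
    ((algebraMap M' (M' ⊗[L] S)).comp f)
    ((Algebra.TensorProduct.includeRight : S →ₐ[L] M' ⊗[L] S).toRingHom.comp g)
    (by
      ext x
      simp only [RingHom.comp_apply, AlgHom.toRingHom_eq_coe, RingHom.coe_coe]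
      rw [hf, hg, AlgHom.commutes]
      rfl)

theorem tensorSemilinearMap_tmul (f : M' →+* M') (g : S →+* S) (l : L → L)
    (hg : ∀ x, g (algebraMap L S x) = algebraMap L S (l x))
    (hf : ∀ x, f (algebraMap L M' x) = algebraMap L M' (l x)) (m : M') (s : S) :
    tensorSemilinearMap f g l hg hf (m ⊗ₜ s) = f m ⊗ₜ g s := by
  simp [tensorSemilinearMap, Algebra.TensorProduct.liftRingHom_tmul]

/-- The semilinear action on `M' ⊗[L] S` obtained from compatible actions on `M'`, `L`, `S`. -/
theorem exists_tensorAction [SMulCommClass L M M'] (θ : (M' ≃ₐ[M] M') →* (S ≃ₐ[K] S))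
    (θL : (M' ≃ₐ[M] M') → L → L)
    (hθS : ∀ σ l, θ σ (algebraMap L S l) = algebraMap L S (θL σ l))
    (hθM : ∀ (σ : M' ≃ₐ[M] M') l, σ (algebraMap L M' l) = algebraMap L M' (θL σ l)) :
    ∃ ρ : (M' ≃ₐ[M] M') →* (M' ⊗[L] S ≃ₐ[M] M' ⊗[L] S),
      ∀ σ m s, ρ σ (m ⊗ₜ s) = σ m ⊗ₜ θ σ s := by
  let act (σ : M' ≃ₐ[M] M') : M' ⊗[L] S →+* M' ⊗[L] S :=
    tensorSemilinearMap (σ : M' →+* M') ((θ σ : S ≃ₐ[K] S) : S →+* S) (θL σ) (hθS σ) (hθM σ)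
  have act_tmul (σ m s) : act σ (m ⊗ₜ s) = σ m ⊗ₜ θ σ s :=
    tensorSemilinearMap_tmul _ _ _ _ _ m s
  have act_mul (σ τ x) : act (σ * τ) x = act σ (act τ x) := by
    induction x with
    | zero => simp
    | add x y hx hy => simp only [map_add, hx, hy]
    | tmul m s => simp only [act_tmul, map_mul]; rfl
  have act_one (x) : act 1 x = x := by
    induction x with
    | zero => simp
    | add x y hx hy => simp only [map_add, hx, hy]
    | tmul m s => simp only [act_tmul, map_one]; rfl
  exact ⟨{
    toFun σ := AlgEquiv.ofRingEquiv (f := RingEquiv.ofRingHom (act σ) (act σ⁻¹)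
        (RingHom.ext fun x => by simp [← act_mul, act_one])
        (RingHom.ext fun x => by simp [← act_mul, act_one]))
        (fun x => by
          rw [Algebra.TensorProduct.algebraMap_apply]
          refine (act_tmul _ _ _).trans ?_
          simp)
    map_one' := AlgEquiv.ext act_one
    map_mul' σ τ := AlgEquiv.ext (act_mul σ τ) }, act_tmul⟩

end TensorAction

/-- The PAC property applied to the twist of the variety with coordinate ring `S` by an action `θ` of
`Gal(M'/M)`: there is an equivariant point which is `K`-rational on `t`. -/
theorem exists_twisted_point {K : Type u} {M M' : Type v} {L S : Type*} [Field K] [Field M]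
    [Algebra K M] (hPAC : IsPACExtension K M) [Field M'] [Algebra M M'] [FiniteDimensional M M']
    [IsGalois M M'] [Algebra K M'] [IsScalarTower K M M'] [Field L] [CommRing S] [Algebra K L]
    [Algebra K S] [Algebra L S] [IsScalarTower K L S] [Algebra L M'] [IsScalarTower K L M']
    [Algebra.FiniteType K S] {r : ℕ} (hr : 1 ≤ r) {t : Fin r → S} (ht : AlgebraicIndependent L t)
    (hsep : ∀ s : S, ∃ p : (MvPolynomial (Fin r) K)[X],
      (p.map (algebraMap _ (FractionRing (MvPolynomial (Fin r) K)))).Separable ∧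
        p.eval₂ ((MvPolynomial.aeval t : _ →ₐ[K] S) : _ →+* S) s = 0)
    (hdom : ∀ (Ω : Type v) [Field Ω] [IsAlgClosed Ω] [Algebra L Ω], IsDomain (S ⊗[L] Ω))
    (θ : (M' ≃ₐ[M] M') →* (S ≃ₐ[K] S)) (θL : (M' ≃ₐ[M] M') → L → L)
    (hθS : ∀ σ l, θ σ (algebraMap L S l) = algebraMap L S (θL σ l))
    (hθM : ∀ (σ : M' ≃ₐ[M] M') l, σ (algebraMap L M' l) = algebraMap L M' (θL σ l))
    (hθt : ∀ σ i, θ σ (t i) = t i) :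
    ∃ χ : S →ₐ[K] M', (∀ i, χ (t i) ∈ Set.range (algebraMap K M')) ∧
      ∀ σ s, σ (χ s) = χ (θ σ s) := by
  have : SMulCommClass L M M' := ⟨fun l m x => by
    simp only [Algebra.smul_def]; ring⟩
  let B := M' ⊗[L] S
  have : IsScalarTower M M' B := inferInstance
  obtain ⟨ρ, hρt⟩ := exists_tensorAction θ θL hθS hθM
  have hρ : ∀ σ x, ρ σ (algebraMap M' B x) = algebraMap M' B (σ x) := fun σ x => by
    refine (hρt σ x 1).trans ?_
    rw [map_one]
    rfl
  -- The coordinate ring of the twisted `M`-form; over `M'` it becomes `M' ⊗[L] S` again.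
  let A := Subalgebra.fixedBy ρ
  let e : M' ⊗[M] A ≃ₐ[M'] B := AlgEquiv.ofBijective _ (bijective_lift_fixedBy ρ hρ)
  have he : ∀ (m : M') (a : A), e (m ⊗ₜ a) = algebraMap M' B m * a := fun m a =>
    Algebra.TensorProduct.lift_tmul _ _ (fun _ _ => Commute.all _ _) m a
  have hK : ∀ k, (1 : M') ⊗ₜ[L] algebraMap K S k = algebraMap M' B (algebraMap K M' k) := fun k => by
    rw [IsScalarTower.algebraMap_apply K L S, IsScalarTower.algebraMap_apply K L M']
    exact (Algebra.TensorProduct.includeRight : S →ₐ[L] B).commutes _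
  have hBdom : IsDomain B := by
    have := hdom (AlgebraicClosure M')
    have h1 : Function.Injective (Algebra.TensorProduct.map
        (IsScalarTower.toAlgHom L M' (AlgebraicClosure M')) (AlgHom.id L S)) :=
      Module.Flat.rTensor_preserves_injective_linearMap (M := S)
        (IsScalarTower.toAlgHom L M' (AlgebraicClosure M')).toLinearMap
        (algebraMap M' (AlgebraicClosure M')).injective
    exact ((Algebra.TensorProduct.comm L _ _).injective.comp h1).isDomain
      ((Algebra.TensorProduct.comm L _ _).toAlgHom.comp (Algebra.TensorProduct.map
        (IsScalarTower.toAlgHom L M' (AlgebraicClosure M')) (AlgHom.id L S))).toRingHom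
  -- Over an algebraic closure containing `M'` the twist disappears, leaving `S ⊗[L] Ω`.
  have hAdom : IsDomain (A ⊗[M] AlgebraicClosure M) := by
    let φ : M' →ₐ[M] AlgebraicClosure M := IsAlgClosed.lift
    let := φ.toRingHom.toAlgebra
    let := (φ.toRingHom.comp (algebraMap L M')).toAlgebra
    have : IsScalarTower L M' (AlgebraicClosure M) := .of_algebraMap_eq fun _ => rfl
    have : IsScalarTower M M' (AlgebraicClosure M) := .of_algebraMap_eq fun x =>
      (φ.commutes x).symm
    have := hdom (AlgebraicClosure M)
    exact isDomain_tensorProduct_of_algEquiv e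
  -- Artin–Tate: `B` is of finite type over `M` and, being spanned by `M'`, finite over `A`.
  have hAft : Algebra.FiniteType M A := by
    have : Algebra.FiniteType L S := .of_restrictScalars_finiteType K L S
    have : Algebra.FiniteType M B := .trans (S := M') inferInstance inferInstance
    let q : A ⊗[M] M' →ₐ[A] B := Algebra.TensorProduct.lift (Algebra.ofId A B)
      (IsScalarTower.toAlgHom M M' B) (fun _ _ => Commute.all _ _)
    have hq : Function.Surjective q.toLinearMap := fun b => by
      obtain ⟨z, rfl⟩ := e.surjective b
      induction z with
      | zero => exact ⟨0, by simp⟩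
      | add x y hx hy =>
        obtain ⟨x', hx⟩ := hx
        obtain ⟨y', hy⟩ := hy
        exact ⟨x' + y', by rw [map_add, map_add, hx, hy]⟩
      | tmul m x =>
        refine ⟨x ⊗ₜ m, ?_⟩
        rw [he, mul_comm]
        exact Algebra.TensorProduct.lift_tmul _ _ (fun _ _ => Commute.all _ _) x m
    have := Module.Finite.of_surjective q.toLinearMap hq
    exact ⟨fg_of_fg_of_fg M A B Algebra.FiniteType.out Module.Finite.fg_top
      Subtype.val_injective⟩
  let tA : Fin r → A := fun i => ⟨1 ⊗ₜ t i, fun σ => by rw [hρt, hθt, map_one]⟩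
  have htA : AlgebraicIndependent M tA :=
    AlgebraicIndependent.of_comp A.val
      ((ht.one_tmul (M' := M')).restrictScalars (algebraMap M M').injective)
  obtain ⟨a, ha⟩ := hPAC.exists_algHom hr A.val Subtype.val_injective htA
    (s := Set.range (fun m : M' => m ⊗ₜ[L] (1 : S)) ∪ Set.range (fun s : S => (1 : M') ⊗ₜ[L] s))
    (by
      refine top_unique fun b _ => ?_
      induction b with
      | zero => exact zero_mem _
      | add x y hx hy => exact add_mem (hx trivial) (hy trivial)
      | tmul m s =>
        have h1 : m ⊗ₜ[L] s = (m ⊗ₜ[L] (1 : S)) * ((1 : M') ⊗ₜ[L] s) := by simp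
        rw [h1]
        exact mul_mem (Algebra.subset_adjoin (.inl ⟨m, rfl⟩))
          (Algebra.subset_adjoin (.inr ⟨s, rfl⟩)))
    (by
      rintro _ (⟨m, rfl⟩ | ⟨s, rfl⟩)
      · refine ⟨(minpoly M m).map MvPolynomial.C, ?_, ?_⟩
        · rw [Polynomial.map_map]
          exact Polynomial.Separable.map (Algebra.IsSeparable.isSeparable M m)
        · have h1 : ((A.val : A →+* B).comp
              ((MvPolynomial.aeval tA : MvPolynomial (Fin r) M →ₐ[M] A) :
                MvPolynomial (Fin r) M →+* A)).comp MvPolynomial.C =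
              (algebraMap M' B).comp (algebraMap M M') := by
            ext x
            simp
            rfl
          rw [Polynomial.eval₂_map, h1]
          refine (Polynomial.hom_eval₂ _ _ _ m).symm.trans ?_
          rw [← Polynomial.aeval_def, minpoly.aeval, map_zero]
      · obtain ⟨p, hp, hp0⟩ := hsep s
        refine ⟨p.map (MvPolynomial.map (algebraMap K M)),
          hp.map_fractionRing _ (MvPolynomial.map_injective _ (algebraMap K M).injective), ?_⟩
        have h1 : ((A.val : A →+* B).comp
            ((MvPolynomial.aeval tA : MvPolynomial (Fin r) M →ₐ[M] A) :
                MvPolynomial (Fin r) M →+* A)).comp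
              (MvPolynomial.map (algebraMap K M)) =
            (Algebra.TensorProduct.includeRight : S →ₐ[L] B).toRingHom.comp
              ((MvPolynomial.aeval t : MvPolynomial (Fin r) K →ₐ[K] S) :
                MvPolynomial (Fin r) K →+* S) := by
          refine MvPolynomial.ringHom_ext (fun k => ?_) fun i => ?_
          · simp only [RingHom.comp_apply, MvPolynomial.map_C, RingHom.coe_coe,
              MvPolynomial.aeval_C, AlgHom.toRingHom_eq_coe, Algebra.TensorProduct.includeRight_apply]
            rw [hK, AlgHom.commutes, IsScalarTower.algebraMap_apply K M M']
            rfl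
          · simp [tA]
        rw [Polynomial.eval₂_map, h1]
        refine (Polynomial.hom_eval₂ _ _ _ s).symm.trans ?_
        rw [hp0, map_zero])
  -- The `M`-point of `A`, extended `M'`-linearly. It is equivariant because `ρ` acts on `M' ⊗[M] A`
  -- through the first factor only.
  let χ' : B →ₐ[M'] M' := (Algebra.TensorProduct.lift (AlgHom.id M' M')
    ((Algebra.ofId M M').comp a) (fun _ _ => Commute.all _ _)).comp e.symm.toAlgHom
  have hχe : ∀ m x, χ' (e (m ⊗ₜ x)) = m * algebraMap M M' (a x) := fun m x => by
    simp [χ', Algebra.ofId_apply]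
  have hequiv : ∀ σ b, σ (χ' b) = χ' (ρ σ b) := by
    intro σ b
    obtain ⟨z, rfl⟩ := e.surjective b
    induction z with
    | zero => simp
    | add x y hx hy => simp only [map_add, hx, hy]
    | tmul m x =>
      have h1 : ρ σ (e (m ⊗ₜ x)) = e (σ m ⊗ₜ x) := by
        rw [he, he, map_mul, hρ, x.2 σ]
      rw [h1, hχe, hχe, map_mul, AlgEquiv.commutes]
  have hχt : ∀ i, χ' (1 ⊗ₜ t i) = algebraMap M M' (a (tA i)) := fun i => by
    have h1 : e (1 ⊗ₜ tA i) = 1 ⊗ₜ t i := by rw [he, map_one, one_mul]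
    rw [← h1, hχe, one_mul]
  refine ⟨{ toRingHom := χ'.toRingHom.comp
              (Algebra.TensorProduct.includeRight : S →ₐ[L] B).toRingHom
            commutes' := fun k => ?_ }, fun i => ?_, fun σ s => ?_⟩
  · change χ' (1 ⊗ₜ algebraMap K S k) = _
    rw [hK, χ'.commutes]
    rfl
  · obtain ⟨k, hk⟩ := ha i
    refine ⟨k, ?_⟩
    change _ = χ' (1 ⊗ₜ t i)
    rw [hχt, ← hk, ← IsScalarTower.algebraMap_apply]
  · change σ (χ' (1 ⊗ₜ s)) = χ' (1 ⊗ₜ θ σ s)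
    rw [hequiv, hρt, map_one]

/-! ### Finite embedding problems for free profinite groups -/

theorem MonoidHom.continuous_of_isOpen_ker {Γ H : Type*} [Group Γ] [TopologicalSpace Γ]
    [IsTopologicalGroup Γ] [Group H] [TopologicalSpace H] [IsTopologicalGroup H] (θ : Γ →* H)
    (h : IsOpen (θ.ker : Set Γ)) : Continuous θ :=
  continuous_of_continuousAt_one θ <| by
    refine Filter.Tendsto.mono_right ?_ (pure_le_nhds (θ 1))
    rw [Filter.tendsto_pure]
    filter_upwards [h.mem_nhds (one_mem θ.ker)] with x hx
    rw [map_one]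
    exact hx

namespace IsFreeProfiniteBasis

variable {Γ : Type v} [Group Γ] [TopologicalSpace Γ] [IsTopologicalGroup Γ] [CompactSpace Γ]
  [TotallyDisconnectedSpace Γ] {X : Type v} {φ : X → Γ} {G Q : Type*} [Group G] [Finite G]
  [Group Q] [Finite Q]

/-- The universal property for finite targets in any universe, with an open kernel in place of
continuity. -/
theorem existsUnique_finite (hφ : IsFreeProfiniteBasis φ) (ψ : X → G)
    (hψ : {x | ψ x ≠ 1}.Finite) :
    ∃! θ : Γ →* G, IsOpen (θ.ker : Set Γ) ∧ ∀ x, θ (φ x) = ψ x := by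
  let H := Shrink.{v} G
  let e : H ≃* G := Shrink.mulEquiv
  let : TopologicalSpace H := ⊥
  have : DiscreteTopology H := ⟨rfl⟩
  have : Finite H := Finite.of_equiv _ e.symm.toEquiv
  obtain ⟨θ, hθ, hu⟩ := hφ.existsUnique_lift (ProfiniteGrp.of H) (fun x => e.symm (ψ x)) (by
    refine Filter.Tendsto.mono_right ?_ (pure_le_nhds _)
    rw [Filter.tendsto_pure]
    refine hψ.subset fun x hx h1 => hx ?_
    change e.symm (ψ x) = 1
    rw [h1, map_one])
  refine ⟨e.toMonoidHom.comp (θ : Γ →* H), ⟨?_, fun x => ?_⟩, fun θ' hθ' => ?_⟩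
  · have h1 : ((e.toMonoidHom.comp (θ : Γ →* H)).ker : Set Γ) = θ ⁻¹' {(1 : H)} := by
      ext x
      simp [MonoidHom.mem_ker]
    rw [h1]
    exact (isOpen_discrete ({1} : Set H)).preimage θ.continuous_toFun
  · have := hθ x
    change e (θ (φ x)) = _
    rw [this, MulEquiv.apply_symm_apply]
  · let θ₁ : Γ →* H := e.symm.toMonoidHom.comp θ'
    have h1 : Continuous θ₁ := θ₁.continuous_of_isOpen_ker (by
      convert hθ'.1 using 2
      ext x
      simp [θ₁, MonoidHom.mem_ker])
    have h2 := hu ⟨θ₁, h1⟩ fun x => by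
      change e.symm (θ' (φ x)) = _
      rw [hθ'.2]
    ext γ
    have h3 : θ₁ γ = θ γ := congrArg (fun f : Γ →ₜ* H => f γ) h2
    change _ = e (θ γ)
    rw [← h3]
    simp [θ₁]

/-- A finite embedding problem for a free profinite group of large rank has a solution whose image
contains the kernel. -/
theorem exists_lift (hφ : IsFreeProfiniteBasis φ) (π : G →* Q) (hπ : Function.Surjective π)
    (ρ : Γ →* Q) (hρ : IsOpen (ρ.ker : Set Γ)) (hcard : (Nat.card G : Cardinal) ≤ Cardinal.mk X) :
    ∃ θ : Γ →* G, IsOpen (θ.ker : Set Γ) ∧ (∀ γ, π (θ γ) = ρ γ) ∧ π.ker ≤ θ.range := by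
  classical
  have := Fintype.ofFinite Q
  have hfin : {x | ρ (φ x) ≠ 1}.Finite := hφ.tendsto_one (hρ.mem_nhds (one_mem ρ.ker))
  -- The normalization `s 1 = 1` makes the map on the basis trivial almost everywhere, hence
  -- convergent to `1`.
  obtain ⟨s, hs, hs1⟩ : ∃ s : Q → G, (∀ q, π (s q) = q) ∧ s 1 = 1 := by
    choose s hs using hπ
    refine ⟨Function.update s 1 1, fun q => ?_, by simp⟩
    rcases eq_or_ne q 1 with rfl | hq
    · simp
    · simp [hq, hs]
  -- Pigeonhole: `|G| = |Q| * |ker π|` basis elements are distributed over the `|Q|` values of `ρ`,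
  -- so some value is taken at least `|ker π|` times. On these elements the lift is altered by every
  -- element of `ker π`.
  obtain ⟨b, X₀, hX₀, hcX₀⟩ : ∃ (b : Q) (X₀ : Finset X), (∀ x ∈ X₀, ρ (φ x) = b) ∧
      Nat.card π.ker ≤ X₀.card := by
    obtain ⟨Y, hY⟩ : ∃ Y : Finset X, Y.card = Nat.card G :=
      (Cardinal.exists_finset_eq_card hcard).imp fun _ h => h.symm
    have h1 : (Finset.univ : Finset Q).card * Nat.card π.ker ≤ Y.card := by
      rw [hY, ← π.ker.card_mul_index, mul_comm, Subgroup.index_ker,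
        MonoidHom.range_eq_top.2 hπ, Finset.card_univ, ← Nat.card_eq_fintype_card,
        Subgroup.card_top]
    obtain ⟨b, -, hb⟩ := Finset.exists_le_card_fiber_of_mul_le_card_of_maps_to
      (f := fun x => ρ (φ x)) (fun _ _ => Finset.mem_univ _) ⟨1, Finset.mem_univ _⟩ h1
    exact ⟨b, _, fun x hx => (Finset.mem_filter.1 hx).2, hb⟩
  obtain ⟨c, hc, hcf⟩ : ∃ c : X → π.ker, (∀ n, ∃ x ∈ X₀, c x = n) ∧ {x | c x ≠ 1}.Finite := by
    have := Fintype.ofFinite π.ker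
    obtain ⟨j⟩ : Nonempty (π.ker ↪ X₀) := Function.Embedding.nonempty_of_card_le (by
      rw [Fintype.card_coe, ← Nat.card_eq_fintype_card]
      exact hcX₀)
    refine ⟨fun x => if hx : x ∈ X₀ then Function.invFun j ⟨x, hx⟩ else 1, fun n =>
      ⟨j n, (j n).2, ?_⟩, X₀.finite_toSet.subset fun x hx => ?_⟩
    · simpa using Function.leftInverse_invFun j.injective n
    · by_contra h
      exact hx (dif_neg h)
  obtain ⟨θ, ⟨hθo, hθ⟩, -⟩ := hφ.existsUnique_finite (fun x => s (ρ (φ x)) * c x)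
    ((hfin.union hcf).subset fun x hx => by
      by_contra h
      simp only [Set.mem_union, Set.mem_ofPred_eq, not_or, not_not] at h
      exact hx (by simp [h.1, h.2, hs1]))
  have hk : ∀ x, π (c x) = 1 := fun x => (c x).2
  refine ⟨θ, hθo, fun γ => ?_, fun n hn => ?_⟩
  · have hu := (hφ.existsUnique_finite (fun x => ρ (φ x)) hfin).unique
      (y₁ := π.comp θ) (y₂ := ρ)
      ⟨Subgroup.isOpen_mono (H₁ := θ.ker) (fun x hx => by
        rw [MonoidHom.mem_ker] at hx ⊢
        simp [hx]) hθo, fun x => by simp [hθ, hs, hk]⟩ ⟨hρ, fun _ => rfl⟩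
    exact DFunLike.congr_fun hu γ
  · obtain ⟨x, hx, hxn⟩ := hc ⟨n, hn⟩
    obtain ⟨y, hy, hy1⟩ := hc 1
    -- Both generators are sent into the coset of `s b`, so the quotient of their images is exactly
    -- `n`.
    refine ⟨(φ y)⁻¹ * φ x, ?_⟩
    simp [hθ, hX₀ x hx, hX₀ y hy, hxn, hy1]

end IsFreeProfiniteBasis

/-! ### From homomorphisms on Gal(M) to specializations -/

theorem exists_finiteGalois_factor {M Ω : Type*} [Field M] [Field Ω] [Algebra M Ω] [IsGalois M Ω]
    {G : Type*} [Group G] (θ : (Ω ≃ₐ[M] Ω) →* G) (hθ : IsOpen (θ.ker : Set (Ω ≃ₐ[M] Ω))) :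
    ∃ (M' : IntermediateField M Ω) (_ : FiniteDimensional M M') (_ : IsGalois M M')
      (θ' : (M' ≃ₐ[M] M') →* G), M'.fixingSubgroup ≤ θ.ker ∧
        ∀ σ, θ' (AlgEquiv.restrictNormalHom M' σ) = θ σ := by
  obtain ⟨M', hfin, hn, hM'⟩ := (krullTopology_mem_nhds_one_iff_of_normal M Ω _).1
    (hθ.mem_nhds (one_mem θ.ker))
  have : IsGalois M M' := IsGalois.mk
  have hk : (AlgEquiv.restrictNormalHom M' : (Ω ≃ₐ[M] Ω) →* _).ker ≤ θ.ker := by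
    rw [IntermediateField.restrictNormalHom_ker]
    exact hM'
  refine ⟨M', hfin, this, MonoidHom.liftOfSurjective _
    (AlgEquiv.restrictNormalHom_surjective Ω) ⟨θ, hk⟩, hM', fun σ => ?_⟩
  exact MonoidHom.liftOfRightInverse_comp_apply _ _ _ ⟨θ, hk⟩ σ

/-- In a Galois extension, an element fixed by the fixing subgroup of `M'` lies in `M'`. -/
theorem IntermediateField.mem_of_forall_fixingSubgroup {M Ω : Type*} [Field M] [Field Ω] [Algebra M Ω]
    [IsGalois M Ω] (M' : IntermediateField M Ω) {x : Ω}
    (h : ∀ σ ∈ M'.fixingSubgroup, σ x = x) : x ∈ M' := by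
  rw [← InfiniteGalois.fixedField_fixingSubgroup M']
  exact fun σ => h σ.1 σ.2

theorem isOpen_ker_restrictNormalHom {K M Ω L : Type*} [Field K] [Field M] [Field Ω] [Field L]
    [Algebra K M] [Algebra M Ω] [Algebra K Ω] [IsScalarTower K M Ω] [Algebra.IsIntegral M Ω]
    [Algebra K L] [Algebra L Ω] [IsScalarTower K L Ω] [Normal K L] [FiniteDimensional K L] :
    IsOpen (((AlgEquiv.restrictNormalHom L : (Ω ≃ₐ[K] Ω) →* (L ≃ₐ[K] L)).comp
      (AlgEquiv.restrictScalarsHom K : (Ω ≃ₐ[M] Ω) →* (Ω ≃ₐ[K] Ω))).ker : Set (Ω ≃ₐ[M] Ω)) := by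
  let b := Module.finBasis K L
  have h1 : IsOpen ((⨅ i, MulAction.stabilizer (Ω ≃ₐ[M] Ω) (algebraMap L Ω (b i)) :
      Subgroup (Ω ≃ₐ[M] Ω)) : Set (Ω ≃ₐ[M] Ω)) := by
    rw [Subgroup.coe_iInf]
    exact isOpen_iInter_of_finite fun i => stabilizer_isOpen_of_isIntegral _
  refine Subgroup.isOpen_mono (fun σ hσ => ?_) h1
  rw [MonoidHom.mem_ker]
  refine AlgEquiv.toLinearEquiv_injective (b.ext' fun i => (algebraMap L Ω).injective ?_)
  exact (AlgEquiv.restrictNormal_commutes _ L (b i)).trans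
    (MulAction.mem_stabilizer_iff.1 (Subgroup.mem_iInf.1 hσ i))

/-- Let `G` act on the coordinate ring `S` over the field of constants `L`, compatibly with a
surjection `π : G → Gal(L/K)`. If `Gal(M)` is free of rank at least `|G|`, then some specialization
of `S` which is `K`-rational on `t` has a kernel that is stable under a group containing `ker π`. -/
theorem IsPACExtension.exists_algHom_kernel_stable {K : Type u} {M : Type v} {L S : Type*}
    [Field K] [Field M] [Algebra K M] (hPAC : IsPACExtension K M) {X : Type v}
    {φ : X → SepAbsGaloisGroup M} (hφ : IsFreeProfiniteBasis φ) [Field L] [CommRing S]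
    [Algebra K L] [Algebra K S] [Algebra L S] [IsScalarTower K L S] [Algebra.FiniteType K S]
    [FiniteDimensional K L] [IsGalois K L] {r : ℕ} (hr : 1 ≤ r) {t : Fin r → S}
    (ht : AlgebraicIndependent L t)
    (hsep : ∀ s : S, ∃ p : (MvPolynomial (Fin r) K)[X],
      (p.map (algebraMap _ (FractionRing (MvPolynomial (Fin r) K)))).Separable ∧
        p.eval₂ ((MvPolynomial.aeval t : _ →ₐ[K] S) : _ →+* S) s = 0)
    (hdom : ∀ (Ω : Type v) [Field Ω] [IsAlgClosed Ω] [Algebra L Ω], IsDomain (S ⊗[L] Ω))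
    {G : Type*} [Group G] [Finite G] (act : G →* (S ≃ₐ[K] S)) (π : G →* (L ≃ₐ[K] L))
    (hπ : Function.Surjective π)
    (hact : ∀ g l, act g (algebraMap L S l) = algebraMap L S (π g l))
    (hactt : ∀ g i, act g (t i) = t i) (hcard : (Nat.card G : Cardinal) ≤ Cardinal.mk X) :
    ∃ (M' : Type v) (_ : Field M') (_ : Algebra K M') (χ : S →ₐ[K] M') (D : Subgroup G),
      (∀ i, χ (t i) ∈ Set.range (algebraMap K M')) ∧
      (∀ g ∈ D, ∀ s, χ s = 0 → χ (act g s) = 0) ∧ π.ker ≤ D := by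
  let Ω := SeparableClosure M
  let ι : L →ₐ[K] Ω := IsSepClosed.lift
  let := ι.toRingHom.toAlgebra
  have : IsScalarTower K L Ω := .of_algebraMap_eq fun x => (ι.commutes x).symm
  -- Since `M` may contain part of `L`, `ρ` need not be onto; hence the image of `θ` is only known
  -- to contain `ker π`.
  let ρ : (Ω ≃ₐ[M] Ω) →* (L ≃ₐ[K] L) := (AlgEquiv.restrictNormalHom L).comp
    (AlgEquiv.restrictScalarsHom K)
  have hρ : ∀ σ l, algebraMap L Ω (ρ σ l) = σ (algebraMap L Ω l) := fun σ l =>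
    AlgEquiv.restrictNormal_commutes _ L l
  obtain ⟨θ, hθo, hθρ, hθk⟩ := hφ.exists_lift π hπ ρ isOpen_ker_restrictNormalHom hcard
  obtain ⟨M', _, _, θ', hM', hθ'⟩ := exists_finiteGalois_factor θ hθo
  -- Automorphisms fixing `M'` are killed by `θ`, hence by `ρ = π ∘ θ`, so they fix `L`.
  have hL : ∀ l, algebraMap L Ω l ∈ M' := fun l =>
    IntermediateField.mem_of_forall_fixingSubgroup M' fun σ hσ => by
      rw [← hρ, ← hθρ, MonoidHom.mem_ker.1 (hM' hσ), map_one, AlgEquiv.one_apply]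
  let := ((algebraMap L Ω).codRestrict M' hL).toAlgebra
  have hLM : ∀ l, ((algebraMap L M' l : M') : Ω) = algebraMap L Ω l := fun l => rfl
  have : IsScalarTower K L M' := .of_algebraMap_eq fun x => Subtype.ext <| by
    rw [hLM, ← IsScalarTower.algebraMap_apply]
    rfl
  obtain ⟨χ, hχt, hχ⟩ := exists_twisted_point hPAC hr ht hsep hdom (act.comp θ')
    (fun σ => π (θ' σ)) (fun σ l => hact _ _) (fun σ l => Subtype.ext <| by
      obtain ⟨σ, rfl⟩ := AlgEquiv.restrictNormalHom_surjective (F := M) (K₁ := M') Ω σ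
      rw [hθ', hθρ, hLM, hρ]
      exact AlgEquiv.restrictNormal_commutes σ M' (algebraMap L M' l)) (fun σ i => hactt _ _)
  refine ⟨M', inferInstance, inferInstance, χ, θ.range, hχt, ?_, hθk⟩
  rintro _ ⟨σ, rfl⟩ s hs
  rw [← hθ']
  exact (hχ _ s).symm.trans (by rw [hs, map_zero])

/-! ### The field of constants of `F` and regularity of `F` over it -/

/-- A nonzero algebraic `x` and its inverse are integral over the integrally closed `K[T]`, so `x`
is a unit of `K[T]`, that is, a constant. -/
theorem mem_range_algebraMap_of_isAlgebraic {K ι E : Type*} [Field K] [Field E]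
    [Algebra (MvPolynomial ι K) E] [IsFractionRing (MvPolynomial ι K) E] [Algebra K E]
    [IsScalarTower K (MvPolynomial ι K) E] {x : E} (hx : IsAlgebraic K x) :
    x ∈ Set.range (algebraMap K E) := by
  have key : ∀ y : E, IsAlgebraic K y → ∃ p : MvPolynomial ι K, algebraMap _ E p = y :=
    fun y hy => IsIntegrallyClosed.algebraMap_eq_of_integral
      (hy.isIntegral.tower_top (A := MvPolynomial ι K))
  rcases eq_or_ne x 0 with rfl | h0
  · exact ⟨0, map_zero _⟩
  obtain ⟨p, hp⟩ := key x hx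
  obtain ⟨q, hq⟩ := key x⁻¹ hx.inv
  have hpq : p * q = 1 := IsFractionRing.injective (MvPolynomial ι K) E (by
    rw [map_mul, hp, hq, mul_inv_cancel₀ h0, map_one])
  obtain ⟨c, -, rfl⟩ := MvPolynomial.isUnit_iff_eq_C_of_isReduced.1 (IsUnit.of_mul_eq_one _ hpq)
  exact ⟨c, by rw [IsScalarTower.algebraMap_apply K (MvPolynomial ι K) E, ← hp]; rfl⟩

section ConstantField

variable (K E F : Type*) [Field K] [Field E] [Field F] [Algebra K E] [Algebra E F] [Algebra K F]
  [IsScalarTower K E F]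

/-- Let `F/E` be a finite Galois extension and let `K` be algebraically closed in `E`. Then the
algebraic closure of `K` in `F` is a finite Galois extension of `K`, and restriction of
automorphisms is onto. -/
theorem finite_isGalois_algebraicClosure [FiniteDimensional E F] [IsGalois E F]
    (hE : ∀ x : E, IsAlgebraic K x → x ∈ Set.range (algebraMap K E)) :
    FiniteDimensional K (algebraicClosure K F) ∧ IsGalois K (algebraicClosure K F) ∧
    ∃ π : (F ≃ₐ[E] F) →* (algebraicClosure K F ≃ₐ[K] algebraicClosure K F),
      Function.Surjective π ∧ ∀ g l, (π g l : F) = g l := by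
  let L := algebraicClosure K F
  have hstab : ∀ (g : F ≃ₐ[E] F) (l : L), g l ∈ L := fun g l =>
    mem_algebraicClosure_iff.2
      (IsAlgebraic.algHom (g.restrictScalars K : F →ₐ[K] F) (mem_algebraicClosure_iff.1 l.2))
  let : MulSemiringAction (F ≃ₐ[E] F) L :=
    { smul g l := ⟨g l, hstab g l⟩
      one_smul _ := rfl
      mul_smul _ _ _ := rfl
      smul_zero g := Subtype.ext (map_zero g)
      smul_add g x y := Subtype.ext (map_add g x.1 y.1)
      smul_one g := Subtype.ext (map_one g)
      smul_mul g x y := Subtype.ext (map_mul g x.1 y.1) }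
  have hsmul : ∀ (g : F ≃ₐ[E] F) (l : L), ((g • l : L) : F) = g l := fun _ _ => rfl
  -- Artin's theorem gives everything for `L/k`, and `k = K` because an invariant constant lies in
  -- `E` and is algebraic over `K`.
  let k := FixedPoints.subfield (F ≃ₐ[E] F) L
  have hKk : ∀ x, algebraMap K L x ∈ k := fun x g => Subtype.ext <| by
    rw [hsmul]
    exact (g.restrictScalars K).commutes x
  have hkK : ∀ x : L, x ∈ k → ∃ y, algebraMap K L y = x := fun x hx => by
    obtain ⟨e, he⟩ := (IsGalois.mem_range_algebraMap_iff_fixed (F := E) (x : F)).2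
      fun g => congrArg Subtype.val (hx g)
    have hxa : IsAlgebraic K (x : F) := mem_algebraicClosure_iff.1 x.2
    rw [← he, isAlgebraic_algebraMap_iff (algebraMap E F).injective] at hxa
    obtain ⟨y, rfl⟩ := hE e hxa
    exact ⟨y, Subtype.ext (by
      rw [← he, ← IsScalarTower.algebraMap_apply]; rfl)⟩
  let e : K ≃+* k := RingEquiv.ofBijective ((algebraMap K L).codRestrict k hKk)
    ⟨((algebraMap K L).codRestrict k hKk).injective, fun x => by
      obtain ⟨y, hy⟩ := hkK x x.2
      exact ⟨y, Subtype.ext hy⟩⟩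
  have he : (algebraMap K L).comp (e.symm : k →+* K) =
      (RingEquiv.refl L : L →+* L).comp (algebraMap k L) := RingHom.ext fun x => by
    obtain ⟨y, rfl⟩ := e.surjective x
    simp only [RingHom.comp_apply, RingHom.coe_coe, RingEquiv.symm_apply_apply]
    rfl
  have h1 : FiniteDimensional K L := Module.Finite.of_equiv_equiv e.symm (RingEquiv.refl L) he
  have h2 : Algebra.IsSeparable K L := Algebra.IsSeparable.of_equiv_equiv e.symm (RingEquiv.refl L) he
  have h3 : Normal K L := Normal.of_equiv_equiv (f := e.symm) (g := RingEquiv.refl L) he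
  refine ⟨h1, IsGalois.mk, (AlgEquiv.restrictNormalHom L).comp (AlgEquiv.restrictScalarsHom K), ?_,
    fun g l => AlgEquiv.restrictNormal_commutes _ L l⟩
  intro τ
  obtain ⟨g, hg⟩ := FixedPoints.toAlgAut_surjective (F ≃ₐ[E] F) L
    (AlgEquiv.ofRingEquiv (f := (τ : L ≃+* L)) fun x => by
      obtain ⟨y, hy⟩ := hkK x x.2
      change τ (x : L) = x
      rw [← hy, τ.commutes])
  refine ⟨g, AlgEquiv.ext fun l => Subtype.ext ?_⟩
  refine (AlgEquiv.restrictNormal_commutes _ L l).trans ?_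
  have := DFunLike.congr_fun hg l
  exact congrArg Subtype.val this

end ConstantField

section

attribute [local instance] MvPolynomial.algebraMvPolynomial

theorem formallyUnramified_mvPolynomial (K L ι : Type*) [Field K] [Field L] [Algebra K L]
    [Algebra.FormallyUnramified K L] :
    Algebra.FormallyUnramified (MvPolynomial ι K) (MvPolynomial ι L) :=
  .of_equiv (Algebra.IsPushout.equiv K (MvPolynomial ι K) L (MvPolynomial ι L))

theorem algebraicIndependent_algebraMap_X {K ι F : Type*} [CommRing K] [CommRing F] [Algebra K F]
    [Algebra (MvPolynomial ι K) F] [IsScalarTower K (MvPolynomial ι K) F]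
    (h : Function.Injective (algebraMap (MvPolynomial ι K) F)) :
    AlgebraicIndependent K fun i => algebraMap (MvPolynomial ι K) F (.X i) := by
  have : (MvPolynomial.aeval fun i => algebraMap (MvPolynomial ι K) F (.X i)) =
      IsScalarTower.toAlgHom K (MvPolynomial ι K) F :=
    MvPolynomial.algHom_ext fun i => by simp
  rw [algebraicIndependent_iff_injective_aeval, this]
  exact h

/-- Regularity of `F` over its constants `L`. Since `F` is étale over `K[T]` and `L[T]` is
unramified over it, `F` is étale over `L[T]`; this supplies the reducedness, and `L` is
algebraically closed in `F`. -/
theorem isDomain_tensorProduct_algebraicClosure {K ι E F : Type*} [Field K] [Field E] [Field F]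
    [Algebra (MvPolynomial ι K) E] [IsFractionRing (MvPolynomial ι K) E] [Algebra K E]
    [IsScalarTower K (MvPolynomial ι K) E] [Algebra E F] [Algebra K F] [IsScalarTower K E F]
    [Algebra (MvPolynomial ι K) F] [IsScalarTower (MvPolynomial ι K) E F]
    [FiniteDimensional E F] [Algebra.IsSeparable E F] [Finite ι]
    [Algebra.IsSeparable K (algebraicClosure K F)]
    (Ω : Type*) [Field Ω] [IsAlgClosed Ω] [Algebra (algebraicClosure K F) Ω] :
    IsDomain (F ⊗[algebraicClosure K F] Ω) := by
  let P := MvPolynomial ι K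
  let L := algebraicClosure K F
  have : IsScalarTower K P F := .of_algebraMap_eq fun x => by
    rw [IsScalarTower.algebraMap_apply K E F, IsScalarTower.algebraMap_apply P E F,
      ← IsScalarTower.algebraMap_apply K P E]
  let t : ι → F := fun i => algebraMap P F (.X i)
  have haeval : (MvPolynomial.aeval t : P →ₐ[K] F) = IsScalarTower.toAlgHom K P F :=
    MvPolynomial.algHom_ext fun i => MvPolynomial.aeval_X t i
  have ht : AlgebraicIndependent L t := (algebraicIndependent_algebraMap_X (by
    rw [IsScalarTower.algebraMap_eq P E F]
    exact (algebraMap E F).injective.comp (IsFractionRing.injective P E))).extendScalars L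
  let := (MvPolynomial.aeval t : MvPolynomial ι L →ₐ[L] F).toRingHom.toAlgebra
  have : IsScalarTower L (MvPolynomial ι L) F := .of_algebraMap_eq fun x =>
    (MvPolynomial.aeval_C t x).symm
  have : FaithfulSMul (MvPolynomial ι L) F := (faithfulSMul_iff_algebraMap_injective _ _).2 ht
  have : IsScalarTower P (MvPolynomial ι L) F := .of_algebraMap_eq fun p => by
    refine (AlgHom.congr_fun haeval p).symm.trans ?_
    exact (MvPolynomial.aeval_map_algebraMap L t p).symm
  have : Algebra.FormallyEtale P E := .of_isLocalization (nonZeroDivisors P)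
  have : Algebra.FormallyEtale E F := .of_isSeparable E F
  have : Algebra.FormallyEtale P F := .comp P E F
  have : Algebra.FormallyEtale K L := .of_isSeparable K L
  have : Algebra.FormallyUnramified P (MvPolynomial ι L) := formallyUnramified_mvPolynomial K L ι
  have : Algebra.FormallyEtale (MvPolynomial ι L) F := .of_restrictScalars (R := P)
  have : Algebra.EssFiniteType P E := .of_isLocalization E (nonZeroDivisors P)
  have : Algebra.EssFiniteType P F := .comp P E F
  have : Algebra.EssFiniteType (MvPolynomial ι L) F := .of_comp P _ F
  have : IsReduced (F ⊗[L] algebraicClosure L Ω) := isReduced_tensorProduct_of_formallyEtale L F _ ι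
  exact isDomain_tensorProduct_of_algebraicClosure_eq_bot L F Ω
    (algebraicClosure.algebraicClosure_eq_bot K F)

end

/-! ### Stability of the kernel and a criterion for irreducibility -/

/-- If the kernel of a specialization `χ` is stable under the kernel of `π : G → Gal(L/K)` and
`χ` maps invariants into `K`, then the kernel of `χ` is stable under `G`. -/
theorem map_act_eq_zero {K L S M' G : Type*} [Field K] [Field L] [CommRing S] [Field M']
    [Algebra K L] [Algebra K S] [Algebra L S] [IsScalarTower K L S] [Algebra K M']
    [FiniteDimensional K L] [IsGalois K L] [Group G] [Finite G] (act : G →* (S ≃ₐ[K] S))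
    (π : G →* (L ≃ₐ[K] L)) (hπ : Function.Surjective π)
    (hact : ∀ g l, act g (algebraMap L S l) = algebraMap L S (π g l)) (χ : S →ₐ[K] M')
    (hinv : ∀ s, (∀ g, act g s = s) → χ s ∈ Set.range (algebraMap K M'))
    (hker : ∀ g ∈ π.ker, ∀ s, χ s = 0 → χ (act g s) = 0) (g : G) (s : S) (hs : χ s = 0) :
    χ (act g s) = 0 := by
  classical
  -- On `ker π`-invariants the group acts through `Gal(L/K)`, so descent writes `x = ∑ d i * w i`
  -- with `w i` invariant under `G`.
  have key : ∀ x, (∀ h ∈ π.ker, act h x = x) → χ x = 0 → χ (act g x) = 0 := by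
    intro x hx hχx
    obtain ⟨ι, _, _, b, d, h1, h2, -⟩ := exists_galois_dual_families K L
    choose sec hsec using hπ
    have hπeq : ∀ z, (∀ h ∈ π.ker, act h z = z) → ∀ g₁ g₂, π g₁ = π g₂ → act g₁ z = act g₂ z := by
      intro z hz g₁ g₂ h12
      have h3 := hz (g₂⁻¹ * g₁) (by rw [MonoidHom.mem_ker, map_mul, map_inv, h12, inv_mul_cancel])
      calc act g₁ z = act (g₂ * (g₂⁻¹ * g₁)) z := by rw [mul_inv_cancel_left]
        _ = act g₂ (act (g₂⁻¹ * g₁) z) := by rw [map_mul]; rfl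
        _ = act g₂ z := by rw [h3]
    let w : ι → S := fun i => ∑ τ, act (sec τ) (algebraMap L S (b i) * x)
    have hb : ∀ i, ∀ h ∈ π.ker, act h (algebraMap L S (b i) * x) = algebraMap L S (b i) * x := by
      intro i h hh
      rw [map_mul, hact, hx h hh, MonoidHom.mem_ker.1 hh, AlgEquiv.one_apply]
    have hw : ∀ i g', act g' (w i) = w i := by
      intro i g'
      rw [map_sum]
      refine Eq.trans ?_ (Equiv.sum_comp (Equiv.mulLeft (π g'))
        (fun τ => act (sec τ) (algebraMap L S (b i) * x)))
      refine Finset.sum_congr rfl fun τ _ => ?_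
      have h3 := hπeq _ (hb i) (g' * sec τ) (sec (π g' * τ)) (by simp [hsec])
      exact (congrArg (fun e : S ≃ₐ[K] S => e (algebraMap L S (b i) * x))
        (map_mul act g' (sec τ))).symm.trans h3
    have hxw : x = ∑ i, algebraMap L S (d i) * w i := by
      have h3 : ∀ τ : L ≃ₐ[K] L, ∑ i, algebraMap L S (d i) *
          act (sec τ) (algebraMap L S (b i) * x) =
          algebraMap L S (∑ i, τ (b i) * d i) * act (sec τ) x := by
        intro τ
        rw [map_sum, Finset.sum_mul]
        refine Finset.sum_congr rfl fun i _ => ?_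
        rw [map_mul, hact, hsec, map_mul]
        ring
      simp only [w, Finset.mul_sum]
      rw [Finset.sum_comm, Finset.sum_eq_single 1]
      · rw [h3]
        simp only [AlgEquiv.one_apply, h1, map_one, one_mul]
        exact (hx _ (by rw [MonoidHom.mem_ker, hsec])).symm
      · intro τ _ hτ
        rw [h3, h2 τ hτ, map_zero, zero_mul]
      · simp
    choose k hk using fun i => hinv (w i) (hw i)
    have hχ : ∀ τ : L → L, (∑ i, χ (algebraMap L S (τ (d i))) * χ (w i)) =
        χ (algebraMap L S (∑ i, τ (d i) * algebraMap K L (k i))) := by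
      intro τ
      rw [map_sum, map_sum]
      refine Finset.sum_congr rfl fun i _ => ?_
      rw [map_mul, map_mul, ← hk, ← IsScalarTower.algebraMap_apply, AlgHom.commutes]
    -- `χ` is injective on the field `L`, so its vanishing at `x` is a linear relation in `L` over
    -- `K`, to which `π g` applies.
    have h0 : ∑ i, d i * algebraMap K L (k i) = 0 := by
      refine ((χ : S →+* M').comp (algebraMap L S)).injective ?_
      refine (hχ id).symm.trans ?_
      rw [map_zero, ← hχx]
      conv_rhs => rw [hxw]
      simp
    have h3 : χ (act g x) = χ (algebraMap L S (∑ i, π g (d i) * algebraMap K L (k i))) := by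
      rw [← hχ]
      conv_lhs => rw [hxw]
      simp only [map_sum, map_mul, hact, hw]
    have h4 : ∑ i, π g (d i) * algebraMap K L (k i) = 0 := by
      rw [← map_zero (π g), ← h0, map_sum]
      simp
    rw [h3, h4, map_zero, map_zero]
  have := Fintype.ofFinite π.ker
  -- The norm of `s` over `ker π` is invariant and vanishes under `χ`. As the target is a field, `χ
  -- (act g (act h s)) = 0` for some `h`; normality of `ker π` then removes `h`.
  have h1 := key (∏ h : π.ker, act h s) (fun h hh => by
    rw [map_prod, ← Equiv.prod_comp (Equiv.mulLeft (⟨h, hh⟩ : π.ker)) (fun h : π.ker => act h s)]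
    exact Finset.prod_congr rfl fun h' _ => by
      simp only [Equiv.coe_mulLeft, Subgroup.coe_mul, map_mul]; rfl)
    (by
      rw [map_prod]
      exact Finset.prod_eq_zero (Finset.mem_univ 1) (by simpa using hs))
  rw [map_prod, map_prod, Finset.prod_eq_zero_iff] at h1
  obtain ⟨h, -, hh⟩ := h1
  have h2 := hker (g * h⁻¹ * g⁻¹) (by
    rw [MonoidHom.mem_ker]
    simp [MonoidHom.mem_ker.1 h.2]) _ hh
  have h3 : act (g * h⁻¹ * g⁻¹) (act g (act h s)) = act (g * h⁻¹ * g⁻¹ * (g * h)) s := by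
    simp only [map_mul]; rfl
  rw [h3] at h2
  simpa using h2

/-- All roots of `f` are simple and are roots of the minimal polynomial of one of them, so `f`
divides that polynomial. -/
theorem irreducible_of_conjugate_roots {K M' : Type*} [Field K] [Field M'] [Algebra K M']
    {f : K[X]} (hsep : f.Separable) (hdeg : f.natDegree ≠ 0)
    (hs : (f.map (algebraMap K M')).Splits)
    (hconj : ∀ y z : M', Polynomial.aeval y f = 0 → Polynomial.aeval z f = 0 →
      ∀ q : K[X], Polynomial.aeval y q = 0 → Polynomial.aeval z q = 0) : Irreducible f := by
  have hf0 : f ≠ 0 := hsep.ne_zero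
  have hf0' : f.map (algebraMap K M') ≠ 0 := Polynomial.map_ne_zero hf0
  obtain ⟨y, hy⟩ := hs.exists_eval_eq_zero (by
    rw [Polynomial.degree_map]
    exact fun h => hdeg (Polynomial.natDegree_eq_of_degree_eq_some h))
  rw [Polynomial.eval_map_algebraMap] at hy
  have hint : IsIntegral K y := IsAlgebraic.isIntegral ⟨f, hf0, hy⟩
  have hdvd : f ∣ minpoly K y := by
    rw [← Polynomial.map_dvd_map' (algebraMap K M')]
    refine hs.dvd_of_roots_le_roots hf0' ?_
    rw [Multiset.le_iff_subset (Polynomial.nodup_roots hsep.map)]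
    intro z hz
    rw [Polynomial.mem_roots hf0', Polynomial.IsRoot, Polynomial.eval_map_algebraMap] at hz
    rw [Polynomial.mem_roots (Polynomial.map_ne_zero (minpoly.ne_zero hint)), Polynomial.IsRoot,
      Polynomial.eval_map_algebraMap]
    exact hconj y z hy hz _ (minpoly.aeval K y)
  have hnu : ¬ IsUnit f := fun h => hdeg (Polynomial.natDegree_eq_zero_of_isUnit h)
  have hirr := minpoly.irreducible hint
  obtain ⟨c, hc⟩ := hdvd
  have hcu : IsUnit c := (hirr.isUnit_or_isUnit hc).resolve_left hnu
  have hassoc : Associated f (minpoly K y) := ⟨hcu.unit, hc.symm⟩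
  exact hassoc.irreducible_iff.2 hirr

/-! ### Clearing denominators and integral closures -/

theorem Polynomial.exists_map_eq_prod_of_splits {P S F : Type*} [CommRing P] [CommRing S] [Field F]
    (j : P →+* S) (i : S →+* F) (hi : Function.Injective i) (f : P[X])
    (hs : (f.map (i.comp j)).Splits) (hS : ∀ z ∈ (f.map (i.comp j)).roots, z ∈ Set.range i) :
    ∃ (c : S) (s : Multiset S), f.map j = Polynomial.C c * (s.map fun y => X - C y).prod := by
  let n := (f.map (i.comp j)).natDegree
  obtain ⟨s, hs'⟩ : ∃ s : Multiset S, s.map i = (f.map (i.comp j)).roots :=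
    have : CanLift F S i (fun z => z ∈ Set.range i) := ⟨fun _ h => h⟩
    (Multiset.canLift i (fun z => z ∈ Set.range i)).prf _ hS
  refine ⟨j (f.coeff n), s, Polynomial.map_injective i hi ?_⟩
  rw [Polynomial.map_map, hs.eq_prod_roots, ← hs', Polynomial.map_mul, Polynomial.map_C,
    Polynomial.map_multiset_prod, Multiset.map_map, Multiset.map_map, Polynomial.leadingCoeff,
    Polynomial.coeff_map]
  simp [n]

theorem Polynomial.exists_map_eq_C_mul {P E : Type*} [CommRing P] [IsDomain P] [Field E]
    [Algebra P E] [IsFractionRing P E] (p : E[X]) :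
    ∃ (b : P) (q : P[X]), b ≠ 0 ∧ q.map (algebraMap P E) = C (algebraMap P E b) * p := by
  obtain ⟨b, hb, h⟩ := IsLocalization.integerNormalization_spec (nonZeroDivisors P) p
  refine ⟨b, _, nonZeroDivisors.ne_zero hb, h.trans ?_⟩
  rw [Polynomial.C_mul', algebraMap_smul]

theorem exists_separable_eval₂_eq_zero {P E F : Type*} [CommRing P] [IsDomain P] [Field E]
    [Field F] [Algebra P E] [IsFractionRing P E] [Algebra E F] {x : F} (hx : IsSeparable E x) :
    ∃ p : P[X], (p.map (algebraMap P E)).Separable ∧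
      p.eval₂ ((algebraMap E F).comp (algebraMap P E)) x = 0 := by
  obtain ⟨b, q, hb, hq⟩ := Polynomial.exists_map_eq_C_mul (P := P) (minpoly E x)
  have hb0 : algebraMap P E b ≠ 0 :=
    (map_ne_zero_iff _ (IsFractionRing.injective P E)).2 hb
  refine ⟨q, ?_, ?_⟩
  · rw [hq]
    refine Polynomial.Separable.of_dvd hx ⟨Polynomial.C (algebraMap P E b)⁻¹, ?_⟩
    rw [mul_right_comm, ← Polynomial.C_mul, mul_inv_cancel₀ hb0, Polynomial.C_1, one_mul]
  · rw [← Polynomial.eval₂_map, hq, Polynomial.eval₂_mul, ← Polynomial.aeval_def x (minpoly E x),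
      minpoly.aeval, mul_zero]

/-- A Bézout identity over `P` itself survives specialization; `f` remains separable wherever `d`
does not vanish. -/
theorem exists_bezout_of_separable {P E : Type*} [CommRing P] [IsDomain P] [Field E]
    [Algebra P E] [IsFractionRing P E] {f : P[X]} (hf : (f.map (algebraMap P E)).Separable) :
    ∃ (d : P) (u w : P[X]), d ≠ 0 ∧
      u * f + w * Polynomial.derivative f = Polynomial.C d := by
  obtain ⟨p, q, hpq⟩ := hf
  obtain ⟨b, u, hb, hu⟩ := Polynomial.exists_map_eq_C_mul (P := P) p
  obtain ⟨c, w, hc, hw⟩ := Polynomial.exists_map_eq_C_mul (P := P) q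
  refine ⟨b * c, Polynomial.C c * u, Polynomial.C b * w, mul_ne_zero hb hc,
    Polynomial.map_injective _ (IsFractionRing.injective P E) ?_⟩
  rw [Polynomial.derivative_map] at hpq
  simp only [Polynomial.map_add, Polynomial.map_mul, Polynomial.map_C, hu, hw, map_mul]
  linear_combination (Polynomial.C (algebraMap P E b) * Polynomial.C (algebraMap P E c)) * hpq

/-- The integral closure of `R` in `F` as an algebra over the field of constants of `F/K`. -/
def constIntegralClosure (K R F : Type*) [Field K] [Field F] [CommRing R] [Algebra K R]
    [Algebra R F] [Algebra K F] [IsScalarTower K R F] : Subalgebra (algebraicClosure K F) F :=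
  { (integralClosure R F).toSubsemiring with
    algebraMap_mem' := fun x => (mem_algebraicClosure_iff'.1 x.2 : IsIntegral K (x : F)).tower_top }

section

variable {K R F : Type*} [Field K] [Field F] [CommRing R] [Algebra K R] [Algebra R F]
  [Algebra K F] [IsScalarTower K R F]

theorem finiteType_constIntegralClosure (E : Type*) [Field E] [Algebra R E] [IsFractionRing R E]
    [Algebra E F] [IsScalarTower R E F] [FiniteDimensional E F] [Algebra.IsSeparable E F]
    [IsDomain R] [IsIntegrallyClosed R] [Algebra.FiniteType K R] :
    Algebra.FiniteType K (constIntegralClosure K R F) := by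
  have : IsNoetherianRing R := Algebra.FiniteType.isNoetherianRing K R
  have : Module.Finite R (integralClosure R F) := IsIntegralClosure.finite R E F _
  have : Algebra.FiniteType K (integralClosure R F) := .trans (S := R) inferInstance inferInstance
  exact this.equiv
    { toFun x := ⟨x, x.2⟩
      invFun x := ⟨x, x.2⟩
      left_inv _ := rfl
      right_inv _ := rfl
      map_mul' _ _ := rfl
      map_add' _ _ := rfl
      commutes' _ := rfl }

theorem exists_algEquiv_constIntegralClosure (E : Type*) [Field E] [Algebra R E] [Algebra E F]
    [IsScalarTower R E F] [Algebra K E] [IsScalarTower K E F] :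
    ∃ act : (F ≃ₐ[E] F) →* (constIntegralClosure K R F ≃ₐ[K] constIntegralClosure K R F),
      ∀ g s, (act g s : F) = g s := by
  have h : ∀ (g : F ≃ₐ[E] F) (s : constIntegralClosure K R F), g s ∈ constIntegralClosure K R F :=
    fun g s => IsIntegral.map (g.restrictScalars R) s.2
  exact ⟨
    { toFun g :=
        { toFun s := ⟨g s, h g s⟩
          invFun s := ⟨g⁻¹ s, h g⁻¹ s⟩
          left_inv s := Subtype.ext (g.symm_apply_apply s)
          right_inv s := Subtype.ext (g.apply_symm_apply s)
          map_mul' x y := Subtype.ext (map_mul g x.1 y.1)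
          map_add' x y := Subtype.ext (map_add g x.1 y.1)
          commutes' x := Subtype.ext ((g.restrictScalars K).commutes x) }
      map_one' := rfl
      map_mul' _ _ := rfl }, fun _ _ => rfl⟩

theorem mem_range_of_forall_fixed {R E F : Type*} [Field E] [Field F] [CommRing R] [IsDomain R]
    [IsIntegrallyClosed R] [Algebra R E] [IsFractionRing R E] [Algebra E F] [Algebra R F]
    [IsScalarTower R E F] [FiniteDimensional E F] [IsGalois E F] {x : F} (hx : IsIntegral R x)
    (hfix : ∀ g : F ≃ₐ[E] F, g x = x) : x ∈ Set.range (algebraMap R F) := by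
  obtain ⟨e, rfl⟩ := (IsGalois.mem_range_algebraMap_iff_fixed (F := E) x).2 hfix
  obtain ⟨y, rfl⟩ := IsIntegrallyClosed.algebraMap_eq_of_integral
    ((isIntegral_algebraMap_iff (algebraMap E F).injective).1 hx)
  exact ⟨y, IsScalarTower.algebraMap_apply R E F y⟩

end

theorem isDomain_tensorProduct_of_subalgebra {L F Ω : Type*} [Field L] [Field F] [Field Ω]
    [Algebra L F] [Algebra L Ω] (S : Subalgebra L F) [IsDomain (F ⊗[L] Ω)] :
    IsDomain (S ⊗[L] Ω) :=
  Function.Injective.isDomain (Algebra.TensorProduct.map S.val (AlgHom.id L Ω)).toRingHom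
    (Module.Flat.rTensor_preserves_injective_linearMap (M := Ω) S.val.toLinearMap
      Subtype.val_injective)

/-- A ring homomorphism on a localization of `P` which restricts to a homomorphism `P → K` takes
values in `K`. -/
theorem mem_range_of_isLocalization_away {K P R M' : Type*} [Field K] [Field M'] [Algebra K M']
    [CommRing P] [CommRing R] [Algebra P R] (h : P) [IsLocalization.Away h R] (ev : P →+* K)
    (ψ : R →+* M') (hψ : ∀ p, ψ (algebraMap P R p) = algebraMap K M' (ev p)) (x : R) :
    ψ x ∈ Set.range (algebraMap K M') := by
  obtain ⟨n, p, hp⟩ := IsLocalization.Away.surj h x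
  have hu : IsUnit (ψ (algebraMap P R h)) := (IsLocalization.Away.algebraMap_isUnit h).map ψ
  refine ⟨ev p / ev h ^ n, ?_⟩
  rw [map_div₀, map_pow, ← hψ, ← hψ, ← hp, map_mul, map_pow]
  exact mul_div_cancel_right₀ _ (pow_ne_zero _ hu.ne_zero)

/-! ### Specializing the splitting ring and proving the theorem -/

/-- The ring `S` produced is the integral closure of `R` in `F`. Its `G`-invariants are `R` because
`R` is integrally closed, which is what lets stability under `ker π` spread to all of `G`. -/
theorem IsPACExtension.exists_equivariant_specialization {K : Type u} {M : Type v} [Field K]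
    [Field M] [Algebra K M] (hPAC : IsPACExtension K M) {X : Type v}
    {φ : X → SepAbsGaloisGroup M} (hφ : IsFreeProfiniteBasis φ) {r : ℕ} (hr : 1 ≤ r)
    {E F R : Type*} [Field E] [Field F] [CommRing R] [IsDomain R]
    [Algebra (MvPolynomial (Fin r) K) E] [IsFractionRing (MvPolynomial (Fin r) K) E]
    [Algebra (MvPolynomial (Fin r) K) F] [Algebra (MvPolynomial (Fin r) K) R]
    [Algebra K E] [Algebra K F] [Algebra K R] [Algebra R E] [IsFractionRing R E] [Algebra E F]
    [Algebra R F] [IsScalarTower K (MvPolynomial (Fin r) K) E] [IsScalarTower K E F]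
    [IsScalarTower (MvPolynomial (Fin r) K) E F] [IsScalarTower K (MvPolynomial (Fin r) K) R]
    [IsScalarTower (MvPolynomial (Fin r) K) R F] [IsScalarTower R E F] [IsScalarTower K R F]
    [FiniteDimensional E F] [IsGalois E F] {h : MvPolynomial (Fin r) K} (h0 : h ≠ 0)
    [IsLocalization.Away h R] (hcard : (Nat.card (F ≃ₐ[E] F) : Cardinal) ≤ Cardinal.mk X) :
    ∃ (a : Fin r → K) (M' : Type v) (_ : Field M') (_ : Algebra K M') (S : Subalgebra K F)
      (χ : S →ₐ[K] M') (j : MvPolynomial (Fin r) K →+* S), MvPolynomial.eval a h ≠ 0 ∧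
      (∀ p, (j p : F) = algebraMap _ F p) ∧
      (∀ p, χ (j p) = algebraMap K M' (MvPolynomial.eval a p)) ∧
      (∀ z : F, IsIntegral R z → z ∈ S) ∧
      ∀ (g : F ≃ₐ[E] F) (s s' : S), (s' : F) = g s → χ s = 0 → χ s' = 0 := by
  let P := MvPolynomial (Fin r) K
  let L := algebraicClosure K F
  have : IsScalarTower K P F := .of_algebraMap_eq fun x => by
    rw [IsScalarTower.algebraMap_apply K E F, IsScalarTower.algebraMap_apply P E F,
      ← IsScalarTower.algebraMap_apply K P E]
  obtain ⟨_, _, π, hπ, hπL⟩ := finite_isGalois_algebraicClosure K E F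
    fun x hx => mem_range_algebraMap_of_isAlgebraic (ι := Fin r) hx
  have : IsIntegrallyClosed R := isIntegrallyClosed_of_isLocalization R (Submonoid.powers h)
    (powers_le_nonZeroDivisors_of_noZeroDivisors h0)
  have : Algebra.FiniteType P R := IsLocalization.finiteType_of_monoid_fg (Submonoid.powers h) R
  have : Algebra.FiniteType K R := .trans (S := P) inferInstance inferInstance
  let S := constIntegralClosure K R F
  have : Algebra.FiniteType K S := finiteType_constIntegralClosure E
  obtain ⟨act, hact⟩ := exists_algEquiv_constIntegralClosure (K := K) (R := R) (F := F) E
  have hactL : ∀ g l, act g (algebraMap L S l) = algebraMap L S (π g l) := fun g l =>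
    Subtype.ext <| by
      rw [hact]
      exact (hπL g l).symm
  let jR : R →+* S := (algebraMap R F).codRestrict S fun x => isIntegral_algebraMap
  let j : P →+* S := jR.comp (algebraMap P R)
  have hj : ∀ p, (j p : F) = algebraMap P F p := fun p =>
    (IsScalarTower.algebraMap_apply P R F p).symm
  let t : Fin r → S := fun i => j (.X i)
  have htj : ((MvPolynomial.aeval t : P →ₐ[K] S) : P →+* S) = j := by
    refine MvPolynomial.ringHom_ext (fun k => Subtype.ext ?_) fun i => ?_
    · rw [hj]
      refine (congrArg Subtype.val (MvPolynomial.aeval_C t k)).trans ?_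
      exact IsScalarTower.algebraMap_apply K P F k
    · exact MvPolynomial.aeval_X t i
  have hinjF : Function.Injective (algebraMap P F) := by
    rw [IsScalarTower.algebraMap_eq P E F]
    exact (algebraMap E F).injective.comp (IsFractionRing.injective P E)
  have ht : AlgebraicIndependent L t := by
    refine AlgebraicIndependent.of_comp S.val ?_
    rw [show S.val ∘ t = fun i => algebraMap P F (.X i) from funext fun i => hj _]
    exact (algebraicIndependent_algebraMap_X hinjF).extendScalars L
  obtain ⟨M', _, _, χ, D, hχt, hD, hkD⟩ := hPAC.exists_algHom_kernel_stable hφ hr ht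
    (fun s => by
      obtain ⟨p, hp, hp0⟩ := exists_separable_eval₂_eq_zero (P := P)
        (Algebra.IsSeparable.isSeparable E (s : F))
      refine ⟨p, ?_, Subtype.val_injective ?_⟩
      · have := hp.map_fractionRing (Y := FractionRing P) (RingHom.id P) Function.injective_id
        rwa [Polynomial.map_id] at this
      · refine (Polynomial.hom_eval₂ p _ (S.val : S →+* F) s).trans (Eq.trans ?_ hp0)
        rw [htj, ← IsScalarTower.algebraMap_eq]
        congr 1
        exact RingHom.ext hj)
    (fun Ω _ _ _ => by
      have := isDomain_tensorProduct_algebraicClosure (K := K) (ι := Fin r) (E := E) (F := F) Ω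
      exact isDomain_tensorProduct_of_subalgebra S)
    act π hπ hactL (fun g i => Subtype.ext <| by
      rw [hact, hj, IsScalarTower.algebraMap_apply P E F, g.commutes]) hcard
  choose a ha using hχt
  have hχj : ∀ p, χ (j p) = algebraMap K M' (MvPolynomial.eval a p) := fun p => by
    have h1 : χ.comp (MvPolynomial.aeval t : P →ₐ[K] S) =
        (Algebra.ofId K M').comp (MvPolynomial.aeval a) :=
      MvPolynomial.algHom_ext fun i => by simp [ha, Algebra.ofId_apply]
    rw [← htj]
    exact AlgHom.congr_fun h1 p
  refine ⟨a, M', inferInstance, inferInstance, S.restrictScalars K, χ, j, fun h1 => ?_, hj, hχj,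
    fun z hz => hz, fun g s s' hs' hs => ?_⟩
  -- `h` is invertible in `S`, so its image `h(a)` cannot vanish.
  · have hu : IsUnit (χ (j h)) :=
      ((IsLocalization.Away.algebraMap_isUnit (S := R) h).map jR).map χ
    rw [hχj, h1, map_zero] at hu
    exact not_isUnit_zero hu
  · have h1 : s' = act g s := Subtype.ext (hs'.trans (hact g s).symm)
    rw [h1]
    refine map_act_eq_zero act π hπ hactL χ (fun x hx => ?_) (fun g hg => hD g (hkD hg)) g s hs
    obtain ⟨y, hy⟩ := mem_range_of_forall_fixed (E := E) (R := R) (x := (x : F)) x.2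
      fun g => by rw [← hact, hx]
    have h2 : x = jR y := Subtype.ext hy.symm
    rw [h2]
    exact mem_range_of_isLocalization_away h (MvPolynomial.eval a) ((χ : S →+* M').comp jR) hχj y

theorem Polynomial.isIntegral_of_isUnit_leadingCoeff {P R F : Type*} [CommRing P] [CommRing R]
    [Nontrivial R] [CommRing F] [Algebra P R] [Algebra R F] [Algebra P F] [IsScalarTower P R F]
    {f : P[X]} (hf : IsUnit (algebraMap P R f.leadingCoeff)) {z : F} (hz : aeval z f = 0) :
    IsIntegral R z := by
  obtain ⟨c, hc⟩ := hf.exists_right_inv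
  refine ⟨C c * f.map (algebraMap P R), monic_C_mul_of_mul_leadingCoeff_eq_one ?_, ?_⟩
  · rw [leadingCoeff_map_of_leadingCoeff_ne_zero _ hf.ne_zero, mul_comm, hc]
  · rw [eval₂_mul, eval₂_map, ← IsScalarTower.algebraMap_eq, ← aeval_def z f, hz, mul_zero]

/-- A specialization of a splitting ring of `f` with a Galois stable kernel keeps `f`
irreducible. -/
theorem irreducible_map_of_equivariant {K P E F M' : Type*} [Field K] [CommRing P] [IsDomain P]
    [Field E] [Field F] [Field M'] [Algebra K E] [Algebra E F] [Algebra K F] [IsScalarTower K E F]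
    [Algebra P E] [IsFractionRing P E] [Algebra P F] [IsScalarTower P E F] [Normal E F]
    [Algebra K M'] (ev : P →+* K) (S : Subalgebra K F) (χ : S →ₐ[K] M') (j : P →+* S)
    (hj : ∀ p, (j p : F) = algebraMap P F p) (hχj : ∀ p, χ (j p) = algebraMap K M' (ev p))
    (hequiv : ∀ (g : F ≃ₐ[E] F) (s s' : S), (s' : F) = g s → χ s = 0 → χ s' = 0)
    {f : P[X]} (hirr : Irreducible (f.map (algebraMap P E))) (hsep : (f.map ev).Separable)
    (hsplit : (f.map (algebraMap P F)).Splits) (hlc : ev f.leadingCoeff ≠ 0)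
    (hS : ∀ z : F, Polynomial.aeval z f = 0 → z ∈ S) : Irreducible (f.map ev) := by
  have hjF : (S.val : S →+* F).comp j = algebraMap P F := RingHom.ext hj
  have hjM : (χ : S →+* M').comp j = (algebraMap K M').comp ev := RingHom.ext hχj
  have hPF : Function.Injective (algebraMap P F) := by
    rw [IsScalarTower.algebraMap_eq P E F]
    exact (algebraMap E F).injective.comp (IsFractionRing.injective P E)
  have hf0 : f.map (algebraMap P F) ≠ 0 :=
    (Polynomial.map_ne_zero_iff hPF).2 fun h => hirr.ne_zero (by rw [h, Polynomial.map_zero])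
  obtain ⟨c, s, hcs⟩ := Polynomial.exists_map_eq_prod_of_splits j (S.val : S →+* F)
    Subtype.val_injective f (by rwa [hjF]) (fun z hz => by
      rw [hjF, Polynomial.mem_roots hf0, Polynomial.IsRoot, Polynomial.eval_map_algebraMap] at hz
      exact ⟨⟨z, hS z hz⟩, rfl⟩)
  have hmap : (f.map ev).map (algebraMap K M') =
      Polynomial.C (χ c) * (s.map fun y => Polynomial.X - Polynomial.C (χ y)).prod := by
    rw [Polynomial.map_map, ← hjM, ← Polynomial.map_map, hcs, Polynomial.map_mul,
      Polynomial.map_C, Polynomial.map_multiset_prod, Multiset.map_map]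
    simp
  have hroot : ∀ y ∈ s, Polynomial.aeval (y : F) f = 0 := by
    intro y hy
    have h1 : (f.map j).eval y = 0 := by
      rw [hcs, Polynomial.eval_mul, Polynomial.eval_multiset_prod, Multiset.map_map]
      refine mul_eq_zero_of_right _ (Multiset.prod_eq_zero (Multiset.mem_map.2 ⟨y, hy, ?_⟩))
      simp
    rw [Polynomial.aeval_def, ← hjF]
    refine (Polynomial.hom_eval₂ f j (S.val : S →+* F) y).symm.trans ?_
    rw [← Polynomial.eval_map, h1, map_zero]
  have hdeg : (f.map ev).natDegree ≠ 0 := by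
    rw [Polynomial.natDegree_map_of_leadingCoeff_ne_zero _ hlc,
      ← Polynomial.natDegree_map_eq_of_injective (IsFractionRing.injective P E) f]
    exact hirr.natDegree_pos.ne'
  have hlift : ∀ y : M', Polynomial.aeval y (f.map ev) = 0 → ∃ x ∈ s, χ x = y := by
    intro y hy
    have h0 : (f.map ev).map (algebraMap K M') ≠ 0 := Polynomial.map_ne_zero hsep.ne_zero
    rw [← Polynomial.eval_map_algebraMap, hmap, Polynomial.eval_mul, Polynomial.eval_C,
      Polynomial.eval_multiset_prod, Multiset.map_map, mul_eq_zero] at hy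
    rcases hy with hy | hy
    · rw [hmap, hy] at h0
      simp at h0
    · obtain ⟨x, hx, hxy⟩ := Multiset.mem_map.1 (Multiset.prod_eq_zero_iff.1 hy)
      simp only [Function.comp_apply, Polynomial.eval_sub, Polynomial.eval_X,
        Polynomial.eval_C] at hxy
      exact ⟨x, hx, (sub_eq_zero.1 hxy).symm⟩
  refine irreducible_of_conjugate_roots (M' := M') hsep hdeg ?_ ?_
  · rw [hmap]
    refine (Polynomial.Splits.C _).mul (Polynomial.Splits.multisetProd fun p hp => ?_)
    obtain ⟨y, -, rfl⟩ := Multiset.mem_map.1 hp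
    exact Polynomial.Splits.X_sub_C _
  · intro y z hy hz q hq
    obtain ⟨y, hys, rfl⟩ := hlift y hy
    obtain ⟨z, hzs, rfl⟩ := hlift z hz
    have hzE : Polynomial.aeval (z : F) (f.map (algebraMap P E)) = 0 := by
      rw [Polynomial.aeval_map_algebraMap, hroot z hzs]
    -- Irreducibility of `f` over `E` makes the Galois group transitive on its roots.
    obtain ⟨g, hg⟩ : ∃ g : F ≃ₐ[E] F, g y = z := by
      refine minpoly.exists_algEquiv_of_root (Algebra.IsAlgebraic.isAlgebraic _) ?_
      rw [← minpoly.eq_of_irreducible hirr hzE, map_mul, Polynomial.aeval_map_algebraMap,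
        hroot y hys, zero_mul]
    rw [Polynomial.aeval_algHom_apply] at hq ⊢
    refine hequiv g _ _ ?_ hq
    have h1 : ∀ x : S, ((Polynomial.aeval x q : S) : F) = Polynomial.aeval (x : F) q := fun x =>
      (Polynomial.aeval_algHom_apply S.val x q).symm
    rw [h1, h1, ← hg]
    exact Polynomial.aeval_algHom_apply (g.restrictScalars K : F →ₐ[K] F) (y : F) q

theorem exists_eval_ne_zero_and_irreducible {K : Type u} {M : Type v} [Field K]
    [Field M] [Algebra K M] (hPAC : IsPACExtension K M) {X : Type v}
    {φ : X → SepAbsGaloisGroup M} (hφ : IsFreeProfiniteBasis φ) {r : ℕ} (hr : 1 ≤ r)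
    {E F : Type*} [Field E] [Field F]
    [Algebra (MvPolynomial (Fin r) K) E] [IsFractionRing (MvPolynomial (Fin r) K) E]
    [Algebra (MvPolynomial (Fin r) K) F] [Algebra K E] [Algebra K F] [Algebra E F]
    [IsScalarTower K (MvPolynomial (Fin r) K) E] [IsScalarTower K E F]
    [IsScalarTower (MvPolynomial (Fin r) K) E F]
    [FiniteDimensional E F] [IsGalois E F]
    (hcard : (Nat.card (F ≃ₐ[E] F) : Cardinal) ≤ Cardinal.mk X) {ι : Type*} [Fintype ι]
    (f : ι → (MvPolynomial (Fin r) K)[X])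
    (hirr : ∀ i, Irreducible ((f i).map (algebraMap _ E)))
    (hsep : ∀ i, ((f i).map (algebraMap _ E)).Separable)
    (hsplit : ∀ i, ((f i).map (algebraMap _ F)).Splits)
    {g : MvPolynomial (Fin r) K} (hg : g ≠ 0) :
    ∃ a : Fin r → K, MvPolynomial.eval a g ≠ 0 ∧
      ∀ i, Irreducible ((f i).map (MvPolynomial.eval a)) := by
  let P := MvPolynomial (Fin r) K
  choose d u w hd hdf using fun i => exists_bezout_of_separable (hsep i)
  have hlc : ∀ i, (f i).leadingCoeff ≠ 0 := fun i h => (hirr i).ne_zero (by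
    rw [Polynomial.leadingCoeff_eq_zero.1 h, Polynomial.map_zero])
  -- The factor `g` gives density; the leading coefficients preserve degrees and make the roots
  -- integral over `R`; the `d i` keep the specializations separable.
  let h : P := g * ((∏ i, (f i).leadingCoeff) * ∏ i, d i)
  have h0 : h ≠ 0 := mul_ne_zero hg (mul_ne_zero (Finset.prod_ne_zero_iff.2 fun i _ => hlc i)
    (Finset.prod_ne_zero_iff.2 fun i _ => hd i))
  have hlch : ∀ i, (f i).leadingCoeff ∣ h := fun i =>
    ((Finset.dvd_prod_of_mem _ (Finset.mem_univ i)).mul_right _).mul_left _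
  have hdh : ∀ i, d i ∣ h := fun i =>
    ((Finset.dvd_prod_of_mem _ (Finset.mem_univ i)).mul_left _).mul_left _
  let R := Localization.subalgebra E (Submonoid.powers h)
    (powers_le_nonZeroDivisors_of_noZeroDivisors h0)
  have : IsLocalization.Away h R := Localization.subalgebra.isLocalization_subalgebra E _ _
  have : IsFractionRing R E := Localization.subalgebra.isFractionRing E _ _
  obtain ⟨a, M', _, _, S, χ, j, ha, hj, hχj, hS, hequiv⟩ :=
    hPAC.exists_equivariant_specialization hφ hr (E := E) (F := F) (R := R) h0 hcard
  have hne : ∀ p, p ∣ h → MvPolynomial.eval a p ≠ 0 := fun p hp h1 =>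
    ha (zero_dvd_iff.1 (h1 ▸ map_dvd (MvPolynomial.eval a) hp))
  refine ⟨a, hne g (dvd_mul_right _ _), fun i => irreducible_map_of_equivariant (E := E) _ S χ j hj
    hχj hequiv (hirr i) ?_ (hsplit i) (hne _ (hlch i)) fun z hz => hS z ?_⟩
  · refine ⟨Polynomial.C (MvPolynomial.eval a (d i))⁻¹ * (u i).map (MvPolynomial.eval a),
      Polynomial.C (MvPolynomial.eval a (d i))⁻¹ * (w i).map (MvPolynomial.eval a), ?_⟩
    have h1 := congrArg (Polynomial.map (MvPolynomial.eval a)) (hdf i)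
    rw [Polynomial.map_add, Polynomial.map_mul, Polynomial.map_mul, Polynomial.map_C] at h1
    rw [Polynomial.derivative_map, mul_assoc, mul_assoc, ← mul_add, h1, ← Polynomial.C_mul,
      inv_mul_cancel₀ (hne _ (hdh i)), Polynomial.C_1]
  · exact Polynomial.isIntegral_of_isUnit_leadingCoeff (P := P)
      (isUnit_of_dvd_unit (map_dvd (algebraMap P R) (hlch i))
        (IsLocalization.Away.algebraMap_isUnit h)) hz

theorem exists_isGalois_splits {E : Type u} [Field E] {ι : Type*} [Fintype ι] (f : ι → E[X])
    (hsep : ∀ i, (f i).Separable) :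
    IsGalois E (∏ i, f i).SplittingField ∧
      ∀ i, ((f i).map (algebraMap E (∏ i, f i).SplittingField)).Splits := by
  have h0 : (∏ i, f i) ≠ 0 := Finset.prod_ne_zero_iff.2 fun i _ => (hsep i).ne_zero
  have hsplit : ((∏ i, f i).map (algebraMap E (∏ i, f i).SplittingField)).Splits :=
    Polynomial.SplittingField.splits _
  refine ⟨?_, fun i => hsplit.of_dvd (Polynomial.map_ne_zero h0)
    (Polynomial.map_dvd _ (Finset.dvd_prod_of_mem _ (Finset.mem_univ i)))⟩
  have : Normal E (∏ i, f i).SplittingField := Normal.of_isSplittingField (∏ i, f i)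
  have : Algebra.IsSeparable E (∏ i, f i).SplittingField := by
    rw [← separableClosure.eq_top_iff, eq_top_iff]
    intro x _
    have hx : x ∈ Algebra.adjoin E ((∏ i, f i).rootSet (∏ i, f i).SplittingField) := by
      rw [Polynomial.SplittingField.adjoin_rootSet]
      trivial
    refine (Algebra.adjoin_le (S := (separableClosure E (∏ i, f i).SplittingField).toSubalgebra)
      fun y hy => ?_) hx
    have hy0 := Polynomial.aeval_eq_zero_of_mem_rootSet hy
    rw [map_prod, Finset.prod_eq_zero_iff] at hy0
    obtain ⟨i, -, hi⟩ := hy0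
    exact mem_separableClosure_iff.2 ((hsep i).of_dvd (minpoly.dvd E y hi))
  exact IsGalois.mk

theorem theorem1p5 (K : Type u) [Field K]
    (h : Set.Infinite {n : ℕ | 1 ≤ n ∧
      ∃ (M : Type v) (_ : Field M) (_ : Algebra K M),
        IsPACExtension K M ∧
        ∃ κ : Cardinal.{v}, (n : Cardinal.{v}) ≤ κ ∧
          IsFreeProfiniteOfRank (SepAbsGaloisGroup M) κ}) :
    IsHilbertian K := by
  intro r hr s f hirr hsep g hg
  let E := FractionRing (MvPolynomial (Fin r) K)
  let p : E[X] := ∏ i, (f i).map (algebraMap (MvPolynomial (Fin r) K) E)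
  obtain ⟨_, hsplit⟩ := exists_isGalois_splits _ hsep
  -- A single `M` is used, with rank above the order of this Galois group; infinitely many `n` are
  -- needed since that order varies with `f`.
  obtain ⟨n, ⟨-, M, _, _, hPAC, _, hκ, X, φ, hφ, rfl⟩, hn⟩ :=
    h.exists_gt (Nat.card (p.SplittingField ≃ₐ[E] p.SplittingField))
  refine exists_eval_ne_zero_and_irreducible hPAC hφ hr (E := E) (F := p.SplittingField)
    ((Nat.cast_le.2 hn.le).trans hκ) f hirr hsep (fun i => ?_) hg
  rw [IsScalarTower.algebraMap_eq (MvPolynomial (Fin r) K) E p.SplittingField,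
    ← Polynomial.map_map]
  exact hsplit i
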